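/- **Conventions.** Let $\Sigma$ be a finite nonempty alphabet and let $\mathcal A=(\Sigma,Q,\iota,\delta,\mathrm{Acc})$ be an alternating automaton: $Q$ is a finite set of states, $\iota\in Q$, $\delta(q,a)$ is a positive Boolean formula over $Q$ (built from states by $\vee$ and $\wedge$) for $q\in Q$, $a\in\Sigma$, and $\mathrm{Acc}$ is a set of infinite sequences of transitions $(q,a,q')\in Q\times\Sigma\times Q$. Let $\widehat\delta$ be the set of all subformulas of the formulas $\delta(q,a)$. $\mathcal A$ is a *Rabin* automaton if for some finite family of pairs $(B_i,G_i)$ of sets of transitions a sequence is in $\mathrm{Acc}$ iff for some $i$ no transition of $B_i$ and some transition of $G_i$ occurs infinitely often in it; it is a *parity* automaton if for some priority function $\Omega:Q\times\Sigma\times Q\to\mathbb N$ a sequence is in $\mathrm{Acc}$ iff the highest priority that occurs infinitely often is even. For an arena $R$ whose edges are labelled by letters, the product $R\times\mathcal A$ has the positions $(v,q)$ and $(v,q,a,b)$ with $b\in\widehat\delta$. From $(v,q)$ the owner of $v$ chooses an edge $v\xrightarrow{a}v'$ of $R$ and the play moves to $(v',q,a,\delta(q,a))$; from $(v,q,a,b_1\vee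 b_2)$ Eve, and from $(v,q,a,b_1\wedge b_2)$ Adam, chooses $i\in\{1,2\}$ and the play moves to $(v,q,a,b_i)$; from $(v,q,a,q')$ it moves to $(v,q')$, which *generates* the letter $a$ and the transition $(q,a,q')$. The word $w=w_0w_1\dots\in\Sigma^\omega$ is in $L(\mathcal A)$ iff Eve has a winning strategy from $(0,\iota)$ in $R_w\times\mathcal A$, where $R_w$ is the infinite path $0\xrightarrow{w_0}1\xrightarrow{w_1}\cdots$ and Eve wins a play iff the generated sequence of transitions is in $\mathrm{Acc}$. *Eve's letter game* is played on $R\times\mathcal A$ from $(v,\iota)$, where $R$ has a single position $v$, belonging to Adam, with a loop for each letter. *Eve's expanded letter game* is played on $R^*\times\mathcal A$ from $(\epsilon,\iota)$, where the positions of $R^*$ are the finite words, all belonging to Adam, with an edge $w\xrightarrow{a}wa$ for each $w\in\Sigma^*$, $a\in\Sigma$. In both games Eve wins a play iff the generated word is not in $L(\mathcal A)$ or the generated sequence of transitions is in $\mathrm{Acc}$. $\mathcal A$ is *$\exists$-GFG* if Eve has a winning strategy in her letter game. A strategy is *positional* if its value depends only on the current position. For a letter $a$ and a positional strategy $\tau$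 of Eve in the one-step arena $R_a\times\mathcal A$, where $R_a$ is the single edge $v\xrightarrow{a}v'$, the *box* of $\tau$ is the set of all triples $(q,a,q')$ such that a play that agrees with $\tau$ leads from $(v,q)$ to $(v',q')$; $\mathrm{Boxes}_{\mathcal A,a}$ is the set of all these boxes. A sequence of boxes $\beta_0,\beta_1,\dots$ is *universally accepting* if every sequence of transitions $(q_i,a_i,q_{i+1})_{i\in\mathbb N}$ with $q_0=\iota$ and $(q_i,a_i,q_{i+1})\in\beta_i$ for all $i$ is in $\mathrm{Acc}$. **Theorem.** Let $\mathcal A$ be a Rabin or parity alternating automaton. 1. Eve's expanded letter game for $\mathcal A$ is positionally determined for Eve: if Eve has a winning strategy in it, then she has a positional winning strategy in it. 2. If $\mathcal A$ is $\exists$-GFG, then there is a positional winning strategy $\sigma$ of Eve in her expanded letter game such that: - the strategy in Eve's letter game that, at the position $(v,q,a,b_1\vee b_2)$ after a history that has generated the word $w\in\Sigma^*$, makes the choice that $\sigma$ makes at $(wa,q,a,b_1\vee b_2)$ is winning; so Eve wins her letter game by a strategy that depends only on the word read so far and the current position; - $\sigma$ is encoded by the map $\sigma'$ on nonempty words, where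 $\sigma'(wa)$ is the set of all triples $(q,a,q')$ such that a partial play of the expanded letter game that agrees with $\sigma$ leads from $(w,q)$ to $(wa,q')$: one has $\sigma'(wa)\in\mathrm{Boxes}_{\mathcal A,a}$ for all $w\in\Sigma^*$, $a\in\Sigma$, and for every $w\in L(\mathcal A)$ the sequence of boxes $\sigma'(w_0),\ \sigma'(w_0w_1),\ \sigma'(w_0w_1w_2),\dots$ is universally accepting. -/

import Mathlib

namespace GFG

/-! ## Arenas, plays, strategies, games -/

/-- A (possibly partial) `L`-arena with set of positions `V`. Positions in `eve` belong to Eve, the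
others to Adam. Transitions are labelled by elements of `L` or by `ε`, which is `none`. -/
structure Arena (V L : Type*) where
  eve : Set V
  trans : V → Option L → V → Prop

/-- A triple (source, label, target). -/
abbrev Edge (V L : Type*) := V × Option L × V

namespace Edge

variable {V L : Type*}

def src (e : Edge V L) : V := e.1

def label (e : Edge V L) : Option L := e.2.1

def tgt (e : Edge V L) : V := e.2.2

end Edge

namespace Arena

variable {V L : Type*} (R : Arena V L)

/-- The triple `e` is a transition of the arena. -/
def IsTrans (e : Edge V L) : Prop := R.trans e.src e.label e.tgt

def IsTerminal (v : V) : Prop := ∀ l v', ¬ R.trans v l v'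

/-- `es` is the list of transitions of a finite path from `v` to `v'`. -/
def IsPath : V → List (Edge V L) → V → Prop
  | v, [], v' => v = v'
  | v, e :: es, v' => e.src = v ∧ R.IsTrans e ∧ IsPath e.tgt es v'

/-- A history `v₀ e₀ v₁ … e_{i-1} v_i` is represented by the list `e₀, …, e_{i-1}` together with
its last position `v_i`. -/
def IsHistory (h : List (Edge V L)) (v : V) : Prop := ∃ v₀, R.IsPath v₀ h v

/-- An infinite play beginning in `v`, given by its sequence of transitions. -/
def IsPlayFrom (v : V) (π : ℕ → Edge V L) : Prop :=
  (π 0).src = v ∧ ∀ i, R.IsTrans (π i) ∧ (π i).tgt = (π (i + 1)).src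

/-- `τ` is a strategy of Eve: it maps every history that ends in a (non-terminal) position of Eve
to a transition that leaves this position. -/
def IsEveStrategy (τ : List (Edge V L) → V → Edge V L) : Prop :=
  ∀ h v, R.IsHistory h v → v ∈ R.eve → ¬ R.IsTerminal v → (τ h v).src = v ∧ R.IsTrans (τ h v)

/-- The infinite play `π` agrees with the strategy `τ` of Eve. -/
def Agrees (τ : List (Edge V L) → V → Edge V L) (π : ℕ → Edge V L) : Prop :=
  ∀ i, (π i).src ∈ R.eve → π i = τ ((List.range i).map π) (π i).src

/-- The strategy that looks at the last position only. -/
def ofPositional (σ : V → Edge V L) : List (Edge V L) → V → Edge V L := fun _ v => σ v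

/-- `σ` represents a positional strategy of Eve. -/
def IsPositionalEveStrategy (σ : V → Edge V L) : Prop := R.IsEveStrategy (ofPositional σ)

/-- There is a finite partial play from `v` to `v'` that agrees with the positional strategy `σ`. -/
def ReachesUnder (σ : V → Edge V L) : V → V → Prop :=
  Relation.ReflTransGen fun v v' => ∃ l, R.trans v l v' ∧ (v ∈ R.eve → σ v = (v, l, v'))

end Arena

/-- `u` is the infinite sequence of the labels other than `ε` along `π`. -/
def IsLabelWord {V L : Type*} (π : ℕ → Edge V L) (u : ℕ → L) : Prop :=
  ∃ φ : ℕ → ℕ, StrictMono φ ∧ (∀ n, (π (φ n)).label = some (u n)) ∧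
    ∀ i, i ∉ Set.range φ → (π i).label = none

/-- A rooted game: an arena (without terminal positions, in all uses below), an initial position,
and a winning condition, which is a set of infinite words of labels. -/
structure Game (V L : Type*) where
  arena : Arena V L
  init : V
  win : Set (ℕ → L)

namespace Game

variable {V L : Type*} (G : Game V L)

/-- The infinite play `π` is winning for Eve. -/
def EveWinsPlay (π : ℕ → Edge V L) : Prop := ∃ u ∈ G.win, IsLabelWord π u

/-- `τ` is a winning strategy of Eve (from the initial position). -/
def IsEveWinning (τ : List (Edge V L) → V → Edge V L) : Prop :=
  G.arena.IsEveStrategy τ ∧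
    ∀ π, G.arena.IsPlayFrom G.init π → G.arena.Agrees τ π → G.EveWinsPlay π

/-- Eve wins the game. -/
def EveWins : Prop := ∃ τ, G.IsEveWinning τ

/-- `σ` represents a positional winning strategy of Eve. -/
def IsPositionalEveWinning (σ : V → Edge V L) : Prop := G.IsEveWinning (Arena.ofPositional σ)

/-- Positional determinacy for Eve: if Eve has a winning strategy, then she has a positional
winning strategy. -/
def PositionallyDeterminedForEve : Prop := G.EveWins → ∃ σ, G.IsPositionalEveWinning σ

end Game

/-! ## Alternating automata -/

/-- Positive Boolean formulas over `Q`. -/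
inductive PosFormula (Q : Type*) where
  | atom (q : Q) : PosFormula Q
  | or (b₁ b₂ : PosFormula Q) : PosFormula Q
  | and (b₁ b₂ : PosFormula Q) : PosFormula Q

namespace PosFormula

variable {Q : Type*}

/-- All subformulas, including the formula itself. -/
def subformulas : PosFormula Q → Set (PosFormula Q)
  | atom q => {atom q}
  | or b₁ b₂ => {or b₁ b₂} ∪ (b₁.subformulas ∪ b₂.subformulas)
  | and b₁ b₂ => {and b₁ b₂} ∪ (b₁.subformulas ∪ b₂.subformulas)

/-- The immediate subformulas. -/
def children : PosFormula Q → Set (PosFormula Q)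
  | atom _ => ∅
  | or b₁ b₂ => {b₁, b₂}
  | and b₁ b₂ => {b₁, b₂}

/-- The formula is a disjunction. -/
def IsOr : PosFormula Q → Prop
  | or _ _ => True
  | _ => False

end PosFormula

/-- An alternating word automaton over the alphabet `A` with states `Q`. The acceptance condition
is the set of accepting sequences of transitions `(q, a, q')`. -/
structure AltAutomaton (A Q : Type*) where
  init : Q
  δ : Q → A → PosFormula Q
  acc : Set (ℕ → Q × A × Q)

/-- The set of the values that `ρ` takes infinitely often. -/
def infSet {T : Type*} (ρ : ℕ → T) : Set T := {t | ∃ᶠ n in Filter.atTop, ρ n = t}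

/-- The positions of the synchronised product of an arena with positions `V` and an automaton:
`(v, q)`, and `(v, q, a, b)` with `b` in the set `D` of subformulas of the transition conditions. -/
inductive ProdPos (V A Q : Type*) (D : Set (PosFormula Q)) where
  | state (v : V) (q : Q) : ProdPos V A Q D
  | formula (v : V) (q : Q) (a : A) (b : D) : ProdPos V A Q D

namespace AltAutomaton

variable {A Q : Type*} (𝒜 : AltAutomaton A Q)

/-- The Rabin condition: for some pair `(B i, G i)` no transition of `B i` and some transition of
`G i` is visited infinitely often. -/
def IsRabin : Prop :=
  ∃ (k : ℕ) (B G : Fin k → Set (Q × A × Q)),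
    𝒜.acc = {ρ | ∃ i, infSet ρ ∩ B i = ∅ ∧ infSet ρ ∩ G i ≠ ∅}

/-- The parity condition: the highest priority seen infinitely often is even. -/
def IsParity : Prop :=
  ∃ Ω : Q × A × Q → ℕ,
    𝒜.acc = {ρ | ∃ p, IsGreatest (infSet fun n => Ω (ρ n)) p ∧ Even p}

/-- The set of all subformulas of formulas in the image of the transition function. -/
def subformulas : Set (PosFormula Q) := {b | ∃ q a, b ∈ (𝒜.δ q a).subformulas}

/-- The positions of the synchronised product of an arena with positions `V` and `𝒜`. -/
abbrev Pos (V : Type*) := ProdPos V A Q 𝒜.subformulas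

/-- The transitions of the synchronised product. A transition that completes the choice of the
transition `(q, a, q')` of `𝒜` is labelled by the letter `a` and by `(q, a, q')`. -/
inductive ProdTrans {V : Type*} (R : Arena V A) :
    𝒜.Pos V → Option (A × (Q × A × Q)) → 𝒜.Pos V → Prop where
  | letter (v v' : V) (q : Q) (a : A) (b : 𝒜.subformulas)
      (hR : R.trans v (some a) v') (hb : b.1 = 𝒜.δ q a) :
      ProdTrans R (ProdPos.state v q) none (ProdPos.formula v' q a b)
  | eps (v v' : V) (q : Q) (hR : R.trans v none v') :
      ProdTrans R (ProdPos.state v q) none (ProdPos.state v' q)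
  | choice (v : V) (q : Q) (a : A) (b b' : 𝒜.subformulas) (hb : b'.1 ∈ b.1.children) :
      ProdTrans R (ProdPos.formula v q a b) none (ProdPos.formula v q a b')
  | leaf (v : V) (q : Q) (a : A) (b : 𝒜.subformulas) (q' : Q) (hb : b.1 = PosFormula.atom q') :
      ProdTrans R (ProdPos.formula v q a b) (some (a, (q, a, q'))) (ProdPos.state v q')

/-- The positions of Eve in the synchronised product. -/
def prodEve {V : Type*} (R : Arena V A) : 𝒜.Pos V → Prop
  | ProdPos.state v _ => v ∈ R.eve
  | ProdPos.formula _ _ _ b => b.1.IsOr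

/-- The synchronised product of an arena and `𝒜`. -/
def prod {V : Type*} (R : Arena V A) : Arena (𝒜.Pos V) (A × (Q × A × Q)) where
  eve := {p | 𝒜.prodEve R p}
  trans := 𝒜.ProdTrans R

end AltAutomaton

/-! ## The letter-giving arenas -/

/-- The path-like arena of the infinite word `w`. -/
def wordArena {A : Type*} (w : ℕ → A) : Arena ℕ A where
  eve := Set.univ
  trans := fun i l j => l = some (w i) ∧ j = i + 1

/-- The arena with one position, which belongs to Adam, and a loop for each letter. -/
def letterArena (A : Type*) : Arena Unit A where
  eve := ∅
  trans := fun _ l _ => ∃ a, l = some a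

/-- The arena of the finite words, all belonging to Adam, with a transition from `w` to `wa` for
each letter `a`. -/
def expandedLetterArena (A : Type*) : Arena (List A) A where
  eve := ∅
  trans := fun w l w' => ∃ a, l = some a ∧ w' = w ++ [a]

/-- The partial arena with two positions `false`, `true` and one transition, from `false` to `true`
and labelled by `a`. -/
def oneStepArena {A : Type*} (a : A) : Arena Bool A where
  eve := ∅
  trans := fun v l v' => v = false ∧ l = some a ∧ v' = true

namespace AltAutomaton

variable {A Q : Type*} (𝒜 : AltAutomaton A Q)

/-! ## Acceptance and letter games -/

/-- The model-checking game of `𝒜` over the word `w`. -/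
def modelCheckingGame (w : ℕ → A) : Game (𝒜.Pos ℕ) (A × (Q × A × Q)) where
  arena := 𝒜.prod (wordArena w)
  init := ProdPos.state 0 𝒜.init
  win := {u | (fun i => (u i).2) ∈ 𝒜.acc}

/-- The language of `𝒜`. -/
def language : Set (ℕ → A) := {w | (𝒜.modelCheckingGame w).EveWins}

/-- Eve's winning condition in her letter games: the word is not in the language, or the sequence
of transitions is accepting. -/
def letterWin : Set (ℕ → A × (Q × A × Q)) :=
  {u | (fun i => (u i).1) ∉ 𝒜.language ∨ (fun i => (u i).2) ∈ 𝒜.acc}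

/-- Eve's letter game. -/
def letterGame : Game (𝒜.Pos Unit) (A × (Q × A × Q)) where
  arena := 𝒜.prod (letterArena A)
  init := ProdPos.state () 𝒜.init
  win := 𝒜.letterWin

/-- Eve's expanded letter game. -/
def expandedLetterGame : Game (𝒜.Pos (List A)) (A × (Q × A × Q)) where
  arena := 𝒜.prod (expandedLetterArena A)
  init := ProdPos.state [] 𝒜.init
  win := 𝒜.letterWin

/-- `𝒜` is `∃`-GFG: Eve wins her letter game. -/
def IsExistsGFG : Prop := 𝒜.letterGame.EveWins

/-! ## Boxes -/

/-- The box of `𝒜`, the letter `a` and the positional strategy `σ` of Eve in the one-step arena. -/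
def box (a : A) (σ : 𝒜.Pos Bool → Edge (𝒜.Pos Bool) (A × (Q × A × Q))) : Set (Q × A × Q) :=
  {t | t.2.1 = a ∧ (𝒜.prod (oneStepArena a)).ReachesUnder σ
    (ProdPos.state false t.1) (ProdPos.state true t.2.2)}

/-- The set of all boxes of `𝒜` and the letter `a`. -/
def boxes (a : A) : Set (Set (Q × A × Q)) :=
  {β | ∃ σ, (𝒜.prod (oneStepArena a)).IsPositionalEveStrategy σ ∧ β = 𝒜.box a σ}

/-- The sequence of boxes `β` is universally accepting: all its paths from the initial state
are accepting. -/
def UniversallyAccepting (β : ℕ → Set (Q × A × Q)) : Prop :=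
  ∀ ρ : ℕ → Q × A × Q, (ρ 0).1 = 𝒜.init → (∀ i, (ρ i).2.2 = (ρ (i + 1)).1) →
    (∀ i, ρ i ∈ β i) → ρ ∈ 𝒜.acc

end AltAutomaton

/-- Nonempty finite words. -/
abbrev NonemptyWord (A : Type*) := {u : List A // u ≠ []}

/-- The last letter of a nonempty word. -/
def NonemptyWord.last {A : Type*} (u : NonemptyWord A) : A := u.1.getLast u.2

/-- The prefix `w 0, …, w i`, of length `i + 1`, of an infinite word. -/
def wordPrefix {A : Type*} (w : ℕ → A) (i : ℕ) : NonemptyWord A :=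
  ⟨(List.range (i + 1)).map w, by simp⟩

namespace AltAutomaton

variable {A Q : Type*} (𝒜 : AltAutomaton A Q)

/-- The map from nonempty words to boxes that encodes a positional strategy `σ` of Eve in her
expanded letter game: the box of `wa` contains `(q, a, q')` if a partial play that agrees with `σ`
leads from `(w, q)` to `(wa, q')`. -/
def strategyBox (σ : 𝒜.Pos (List A) → Edge (𝒜.Pos (List A)) (A × (Q × A × Q)))
    (u : NonemptyWord A) : Set (Q × A × Q) :=
  {t | t.2.1 = u.last ∧ (𝒜.prod (expandedLetterArena A)).ReachesUnder σ
    (ProdPos.state u.1.dropLast t.1) (ProdPos.state u.1 t.2.2)}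

/-- The word read along a history of a letter game. -/
def wordRead {V : Type*} (h : List (Edge V (A × (Q × A × Q)))) : List A :=
  (h.filterMap Edge.label).map Prod.fst

/-- The position of the expanded letter game that corresponds to a position of the letter game
reached after reading `w`. At `(v, q, a, b)` the letter `a` has been chosen after `w`. -/
def expandPos (w : List A) : 𝒜.Pos Unit → 𝒜.Pos (List A)
  | ProdPos.state _ q => ProdPos.state w q
  | ProdPos.formula _ q a b => ProdPos.formula (w ++ [a]) q a b

/-- The position of the letter game that corresponds to a position of the expanded one. -/
def collapsePos : 𝒜.Pos (List A) → 𝒜.Pos Unit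
  | ProdPos.state _ q => ProdPos.state () q
  | ProdPos.formula _ q a b => ProdPos.formula () q a b

/-- The strategy in the letter game that plays as the positional strategy `σ` does in the expanded
letter game. Its value depends only on the word read so far and on the current position. -/
def letterStrategy (σ : 𝒜.Pos (List A) → Edge (𝒜.Pos (List A)) (A × (Q × A × Q))) :
    List (Edge (𝒜.Pos Unit) (A × (Q × A × Q))) → 𝒜.Pos Unit →
      Edge (𝒜.Pos Unit) (A × (Q × A × Q)) :=
  fun h v =>
    let e := σ (𝒜.expandPos (wordRead h) v)
    (𝒜.collapsePos e.src, e.label, 𝒜.collapsePos e.tgt)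

end AltAutomaton

end GFG

/-! Rabin and parity acceptance are complements of Streett conditions, so Eve loses a play of the
expanded letter game exactly when its word is in the language and its transition sequence is
Streett. A position of that game determines the word read so far, so only the transition sequences
of different histories of a position can differ.

Given a winning strategy `τ`, the positional strategy chooses at each position `v` the history of
`v` under `τ` that looks worst for Eve, and moves as `τ` does after it. "Worst" is measured by the
total preorder of `exists_streett_preorder`. Along a play of the new strategy with transition
sequence `c`, the word of the worst history at each stage dominates the previous one extended by the
current letter of `c`. Finite branching gives the worst histories a limit play
(`Arena.exists_limit_play`), which agrees with `τ` and reads the same word. The preorder is built so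
that this limit is Streett whenever `c` is; since `τ` wins, `c` is not Streett or the word is
outside the language. This is `Game.positionallyDetermined_of_streett`.

The preorder is recursive in the set of Streett pairs. A scan waits for visits to `B (e 0)`, `B (e
1)`, ..., where `e` repeats every pair infinitely often. Earlier visits are better; on ties, a
longer suffix free of the `G` currently awaited is better; on further ties, the suffixes are
compared by the preorder for the remaining pairs.

For the second part, forgetting the word carries a letter game strategy to the expanded game
(`IsExistsGFG.eveWins_expanded`), where it becomes positional by the first part. Recomputing the
word from the history carries the result back (`letterStrategy_isEveWinning`). Each path through the
boxes of the strategy is approximated by partial plays agreeing with it; a limit of these plays has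
that path as its transition sequence, so the path is accepting on words of the language. -/

namespace GFG

open Filter

/-! ## A preorder on finite words that favours the Streett player -/

section Streett

variable {T ι : Type*}

/-- Every `s ∈ S` satisfies: `B s` is visited infinitely often or `G s` is visited finitely often. -/
def IsStreett (B G : ι → Set T) (S : Finset ι) (c : ℕ → T) : Prop :=
  ∀ s ∈ S, (∃ᶠ n in atTop, c n ∈ B s) ∨ ∀ᶠ n in atTop, c n ∉ G s

/-- Along the filter `F`, the words `z n` converge to the infinite word `y`. -/
def IsWordLimit (F : Filter ℕ) (z : ℕ → List T) (y : ℕ → T) : Prop :=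
  ∀ m, ∀ᶠ n in F, (z n).take m = (List.range m).map y

/-! ### Scanning a word for awaited visits -/

/-- The number of binary digits `1`. -/
def popCount (v : ℕ) : ℕ := (Nat.digits 2 v).sum

theorem popCount_two_mul (v : ℕ) : popCount (2 * v) = popCount v := by
  rcases Nat.eq_zero_or_pos v with rfl | h
  · rfl
  · have := Nat.digits_add 2 (by norm_num) 0 v (by norm_num) (Or.inr h.ne')
    simp only [zero_add] at this
    simp [popCount, this]

theorem popCount_two_mul_add_one (v : ℕ) : popCount (2 * v + 1) = popCount v + 1 := by
  have := Nat.digits_add 2 (by norm_num) 1 v (by norm_num) (Or.inl (by norm_num))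
  rw [add_comm] at this
  rw [popCount, this, List.sum_cons, add_comm, popCount]

theorem popCount_two_pow_mul (k v : ℕ) : popCount (2 ^ k * v) = popCount v := by
  induction k with
  | zero => simp
  | succ k ih => rw [pow_succ', mul_assoc, popCount_two_mul, ih]

open Classical in
/-- One step of the scan of a word that waits in turn for visits to `B (e 0)`, `B (e 1)`, …
The number records in binary when these visits occur; the list is the part of the word after the
last visit, and after the last occurrence of `G s` for the current `s`. -/
noncomputable def scanStep (B G : ι → Set T) (e : ℕ → ι) (st : ℕ × List T) (c : T) :
    ℕ × List T :=
  if c ∈ B (e (popCount st.1)) then (2 * st.1 + 1, [])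
  else if c ∈ G (e (popCount st.1)) then (2 * st.1, [])
  else (2 * st.1, st.2 ++ [c])

/-- The result of the scan of a word. -/
noncomputable def scan (B G : ι → Set T) (e : ℕ → ι) (x : List T) : ℕ × List T :=
  x.foldl (scanStep B G e) (0, [])

variable {B G : ι → Set T} {e : ℕ → ι}

theorem scan_concat (x : List T) (c : T) :
    scan B G e (x ++ [c]) = scanStep B G e (scan B G e x) c := by
  simp [scan]

theorem scanStep_fst_of_mem {st : ℕ × List T} {c : T} (h : c ∈ B (e (popCount st.1))) :
    (scanStep B G e st c).1 = 2 * st.1 + 1 := by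
  simp [scanStep, h]

theorem scanStep_fst_of_notMem {st : ℕ × List T} {c : T} (h : c ∉ B (e (popCount st.1))) :
    (scanStep B G e st c).1 = 2 * st.1 := by
  unfold scanStep
  split_ifs <;> rfl

theorem scanStep_of_notMem {st : ℕ × List T} {c : T} (h : c ∉ B (e (popCount st.1)))
    (h' : c ∉ G (e (popCount st.1))) : scanStep B G e st c = (2 * st.1, st.2 ++ [c]) := by
  simp [scanStep, h, h']

theorem two_mul_le_scanStep (st : ℕ × List T) (c : T) : 2 * st.1 ≤ (scanStep B G e st c).1 := by
  unfold scanStep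
  split_ifs <;> simp

theorem scanStep_le (st : ℕ × List T) (c : T) : (scanStep B G e st c).1 ≤ 2 * st.1 + 1 := by
  unfold scanStep
  split_ifs <;> simp

/-- Every letter appends one binary digit, so the number for `x` forms the leading digits of the
number for `x ++ y`. Together with `scan_append_lt` this compares words through their prefixes. -/
theorem two_pow_mul_le_scan_append (x y : List T) :
    2 ^ y.length * (scan B G e x).1 ≤ (scan B G e (x ++ y)).1 := by
  induction y using List.reverseRecOn with
  | nil => simp
  | append_singleton y c ih =>
    rw [← List.append_assoc, scan_concat]
    refine le_trans ?_ (two_mul_le_scanStep _ _)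
    rw [List.length_append, List.length_singleton, pow_succ', mul_assoc]
    gcongr

theorem scan_append_lt (x y : List T) :
    (scan B G e (x ++ y)).1 < 2 ^ y.length * ((scan B G e x).1 + 1) := by
  induction y using List.reverseRecOn with
  | nil => simp
  | append_singleton y c ih =>
    rw [← List.append_assoc, scan_concat]
    refine lt_of_le_of_lt (scanStep_le _ _) ?_
    rw [List.length_append, List.length_singleton, pow_succ', mul_assoc]
    omega

/-- The list is emptied at each awaited visit and at each letter of the current `G`; the stage
changes only at such a visit, so what remains is a suffix avoiding `G` of the present stage. -/
theorem scan_snd (x : List T) : (∃ d, d + (scan B G e x).2.length = x.length ∧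
    (scan B G e x).2 = x.drop d) ∧
    ∀ t ∈ (scan B G e x).2, t ∉ G (e (popCount (scan B G e x).1)) := by
  induction x using List.reverseRecOn with
  | nil => simp [scan]
  | append_singleton x c ih =>
    obtain ⟨⟨d, hd, hd'⟩, ih⟩ := ih
    rw [scan_concat]
    by_cases hB : c ∈ B (e (popCount (scan B G e x).1))
    · simp [scanStep, hB]
    by_cases hG : c ∈ G (e (popCount (scan B G e x).1))
    · simp [scanStep, hB, hG]
    rw [scanStep_of_notMem hB hG]
    refine ⟨⟨d, by simp; omega, ?_⟩, ?_⟩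
    · simp only
      rw [List.drop_append_of_le_length (by omega), hd']
    · simp only [popCount_two_mul, List.mem_append, List.mem_singleton]
      rintro t (ht | rfl)
      · exact ih t ht
      · exact hG

/-- Lexicographic comparison of the results of scans. -/
def scanRel (r : ℕ → List T → List T → Prop) (p q : ℕ × List T) : Prop :=
  q.1 < p.1 ∨ q.1 = p.1 ∧ (q.2.length < p.2.length ∨
    q.2.length = p.2.length ∧ r p.1 p.2 q.2)

theorem scanRel_total {r : ℕ → List T → List T → Prop} (hr : ∀ v x y, r v x y ∨ r v y x)
    (p q : ℕ × List T) : scanRel r p q ∨ scanRel r q p := by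
  unfold scanRel
  rcases lt_trichotomy p.1 q.1 with h | h | h
  · tauto
  · rcases lt_trichotomy p.2.length q.2.length with h' | h' | h'
    · right; right; exact ⟨h, .inl h'⟩
    · rcases hr p.1 p.2 q.2 with h'' | h''
      · left; right; exact ⟨h.symm, .inr ⟨h'.symm, h''⟩⟩
      · right; right; exact ⟨h, .inr ⟨h', h ▸ h''⟩⟩
    · left; right; exact ⟨h.symm, .inl h'⟩
  · tauto

theorem scanRel_trans {r : ℕ → List T → List T → Prop}
    (hr : ∀ v x y z, r v x y → r v y z → r v x z) {p q s : ℕ × List T}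
    (h : scanRel r p q) (h' : scanRel r q s) : scanRel r p s := by
  unfold scanRel at *
  rcases h with h | ⟨h, h1⟩ <;> rcases h' with h' | ⟨h', h1'⟩
  · left; omega
  · left; omega
  · left; omega
  · right
    refine ⟨h'.trans h, ?_⟩
    rcases h1 with h1 | ⟨h1, h2⟩ <;> rcases h1' with h1' | ⟨h1', h2'⟩
    · left; omega
    · left; omega
    · left; omega
    · right
      exact ⟨h1'.trans h1, hr _ _ _ _ h2 (h ▸ h2')⟩

theorem exists_frequent_enumeration (S : Finset ι) (hS : S.Nonempty) :
    ∃ e : ℕ → ι, (∀ n, e n ∈ S) ∧ ∀ s ∈ S, ∃ᶠ n in atTop, e n = s := by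
  have : Nonempty S := hS.to_subtype
  obtain ⟨f, hf⟩ := exists_surjective_nat S
  -- Ignoring the second component of the pairing repeats every value infinitely often.
  refine ⟨fun n => f n.unpair.1, fun n => (f _).2, fun s hs => ?_⟩
  obtain ⟨k, hk⟩ := hf ⟨s, hs⟩
  rw [frequently_atTop]
  exact fun m => ⟨Nat.pair k m, Nat.right_le_pair _ _, by simp [hk]⟩

/-- If the scan of `y` meets infinitely many of the awaited visits, then all `B s` are visited
infinitely often. -/
theorem frequently_mem_of_scan (y : ℕ → T)
    (h : ∃ᶠ n in atTop, y n ∈ B (e (popCount (scan B G e ((List.range n).map y)).1))) (s : ι)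
    (hs : ∃ᶠ n in atTop, e n = s) : ∃ᶠ n in atTop, y n ∈ B s := by
  classical
  set j : ℕ → ℕ := fun n => popCount (scan B G e ((List.range n).map y)).1 with hj
  have h0 : j 0 = 0 := rfl
  have hstep : ∀ n, j (n + 1) = if y n ∈ B (e (j n)) then j n + 1 else j n := by
    intro n
    have : j (n + 1) = popCount (scanStep B G e (scan B G e ((List.range n).map y)) (y n)).1 := by
      rw [← scan_concat]; simp [hj, List.range_succ]
    rw [this]
    split_ifs with hn
    · rw [scanStep_fst_of_mem hn, popCount_two_mul_add_one]
    · rw [scanStep_fst_of_notMem hn, popCount_two_mul]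
  have hle : ∀ n, j n ≤ n := by
    intro n
    induction n with
    | zero => simp [h0]
    | succ n ih => rw [hstep]; split_ifs <;> omega
  -- The stage moves up by one at a time, and infinitely many visits forbid it to stall. As `j n ≤
  -- n`, the visit ending stage `k` occurs no earlier than time `k`.
  have hex : ∀ k, ∃ n, j n = k ∧ y n ∈ B (e k) := by
    intro k
    induction k with
    | zero =>
      by_contra! hcon
      have : ∀ n, j n = 0 := by
        intro n
        induction n with
        | zero => exact h0
        | succ n ih => rw [hstep, if_neg (by rw [ih]; exact hcon n ih), ih]
      obtain ⟨n, hn⟩ := h.exists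
      exact hcon n (this n) (this n ▸ hn)
    | succ k ih =>
      obtain ⟨n, hn, hn'⟩ := ih
      by_contra! hcon
      have : ∀ m, j (n + 1 + m) = k + 1 := by
        intro m
        induction m with
        | zero => rw [add_zero, hstep, hn, if_pos hn']
        | succ m ih => rw [← add_assoc, hstep, if_neg (by rw [ih]; exact hcon _ ih), ih]
      obtain ⟨m, hm, hm'⟩ := (frequently_atTop.1 h) (n + 1)
      obtain ⟨m, rfl⟩ := Nat.exists_eq_add_of_le hm
      exact hcon _ (this m) (this m ▸ hm')
  rw [frequently_atTop]
  intro m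
  obtain ⟨k, hk, rfl⟩ := (frequently_atTop.1 hs) m
  obtain ⟨n, hn, hn'⟩ := hex k
  exact ⟨n, by have := hle n; omega, hn'⟩

/-- There is a total preorder on finite words such that a sequence of words that dominates an
infinite word `c` step by step has only limits satisfying the Streett condition if `c` does. -/
theorem exists_streett_preorder (B G : ι → Set T) (S : Finset ι) :
    ∃ r : List T → List T → Prop, (∀ x y, r x y ∨ r y x) ∧ (∀ x y z, r x y → r y z → r x z) ∧
      ∀ (F : Filter ℕ) [F.NeBot] (z : ℕ → List T) (c y : ℕ → T), F ≤ atTop →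
        (∀ᶠ n in atTop, (z n).length = n) → (∀ᶠ n in atTop, r (z (n + 1)) (z n ++ [c n])) →
        IsWordLimit F z y → IsStreett B G S c → IsStreett B G S y := by
  classical
  induction S using Finset.strongInduction with
  | H S IH =>
  rcases S.eq_empty_or_nonempty with rfl | hS
  · exact ⟨fun _ _ => True, by simp, by simp, by simp [IsStreett]⟩
  obtain ⟨e, heS, hefreq⟩ := exists_frequent_enumeration S hS
  -- One preorder for each stage `j`, dealing with the pairs other than the one awaited there.
  choose r hr_total hr_trans hr using fun j => IH _ (Finset.erase_ssubset (heS j))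
  refine ⟨fun p q => scanRel (fun v => r (popCount v)) (scan B G e p) (scan B G e q),
    fun p q => scanRel_total (fun _ => hr_total _) _ _,
    fun p q s => scanRel_trans (fun _ => hr_trans _), ?_⟩
  intro F _ z c y hF hlen hrel hlim hc
  by_cases hfreq :
    ∃ᶠ n in atTop, y n ∈ B (e (popCount (scan B G e ((List.range n).map y)).1))
  · exact fun s hs => .inl (frequently_mem_of_scan y hfreq s (hefreq s hs))
  -- From here on the scan of `y` is stuck: after time `m` it only appends zeros.
  obtain ⟨m, hm⟩ := eventually_atTop.1 (not_frequently.1 hfreq)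
  obtain ⟨N₀, hN₀⟩ := eventually_atTop.1 (hlen.and hrel)
  set V : ℕ → ℕ := fun n => (scan B G e ((List.range n).map y)).1 with hV
  have hVm : ∀ k, V (m + k) = 2 ^ k * V m := by
    intro k
    induction k with
    | zero => simp
    | succ k ih =>
      have : V (m + k + 1) = 2 * V (m + k) := by
        simp only [hV, List.range_succ, List.map_append, List.map_cons, List.map_nil, scan_concat]
        exact scanStep_fst_of_notMem (hm _ (by omega))
      rw [← add_assoc, this, ih]; ring
  have hdouble : ∀ n ≥ N₀, ∀ k,
      2 ^ k * (scan B G e (z n)).1 ≤ (scan B G e (z (n + k))).1 := by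
    intro n hn k
    induction k with
    | zero => simp
    | succ k ih =>
      have h1 : (scan B G e (z (n + k) ++ [c (n + k)])).1 ≤ (scan B G e (z (n + k + 1))).1 := by
        rcases (hN₀ (n + k) (by omega)).2 with h | ⟨h, -⟩
        exacts [h.le, h.le]
      have h2 := two_mul_le_scanStep (B := B) (G := G) (e := e) (scan B G e (z (n + k))) (c (n + k))
      rw [← scan_concat] at h2
      rw [← add_assoc, pow_succ', mul_assoc]
      omega
  have hF' : ∀ N, ∀ᶠ n in F, N ≤ n := fun N => hF (eventually_ge_atTop N)
  -- A larger number at time `n` would persist in the leading digits of all later words, but some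
  -- later word starts with the first `n` letters of `y`.
  have hupper : ∀ n ≥ N₀, (scan B G e (z n)).1 ≤ V n := by
    intro n hn
    obtain ⟨N, hN, hN'⟩ := ((hlim n).and (hF' n)).exists
    obtain ⟨k, rfl⟩ := Nat.exists_eq_add_of_le hN'
    have h1 := hdouble n hn k
    have h2 := scan_append_lt (B := B) (G := G) (e := e) ((z (n + k)).take n) ((z (n + k)).drop n)
    rw [List.take_append_drop, List.length_drop, (hN₀ (n + k) (by omega)).1, hN,
      Nat.add_sub_cancel_left] at h2
    exact Nat.lt_succ_iff.1 (Nat.lt_of_mul_lt_mul_left (lt_of_le_of_lt h1 h2))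
  obtain ⟨N₁, hN₁, hN₁'⟩ := ((hlim m).and (hF' (max m N₀))).exists
  have hmN₁ : m ≤ N₁ := le_trans (le_max_left _ _) hN₁'
  have hNN₁ : N₀ ≤ N₁ := le_trans (le_max_right _ _) hN₁'
  -- For the lower bound, `z N₁` shares with `y` the first `m` letters, which contain all the visits
  -- of `y`; doubling then keeps up with `V`.
  have hval : ∀ n ≥ N₁, (scan B G e (z n)).1 = V n := by
    intro n hn
    refine le_antisymm (hupper n (by omega)) ?_
    obtain ⟨k, rfl⟩ := Nat.exists_eq_add_of_le hn
    have h2 := two_pow_mul_le_scan_append (B := B) (G := G) (e := e) ((z N₁).take m)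
      ((z N₁).drop m)
    rw [List.take_append_drop, List.length_drop, (hN₀ N₁ (by omega)).1, hN₁] at h2
    refine le_trans ?_ (hdouble N₁ (by omega) k)
    have h3 : V (N₁ + k) = 2 ^ k * (2 ^ (N₁ - m) * V m) := by
      rw [← mul_assoc, ← pow_add, ← hVm]; congr 1; omega
    rw [h3]
    gcongr
  set j := popCount (V m) with hj
  have hpc : ∀ n ≥ N₁, popCount (scan B G e (z n)).1 = j := by
    intro n hn
    obtain ⟨k, rfl⟩ := Nat.exists_eq_add_of_le (hmN₁.trans hn)
    rw [hval _ hn, hVm, popCount_two_pow_mul]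
  have hVs : ∀ n ≥ N₁, V (n + 1) = 2 * V n := by
    intro n hn
    obtain ⟨k, rfl⟩ := Nat.exists_eq_add_of_le (hmN₁.trans hn)
    rw [add_assoc, hVm, hVm]; ring
  -- Such a visit would append a digit `1` and push the number above `V (n + 1)`.
  have hcB : ∀ n ≥ N₁, c n ∉ B (e j) := by
    intro n hn hmem
    rw [← hpc n hn] at hmem
    have h1 : (scan B G e (z n ++ [c n])).1 ≤ (scan B G e (z (n + 1))).1 := by
      rcases (hN₀ n (by omega)).2 with h | ⟨h, -⟩
      exacts [h.le, h.le]
    rw [scan_concat, scanStep_fst_of_mem hmem, hval n hn, hval _ (by omega), hVs n hn] at h1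
    omega
  have hcG : ∀ᶠ n in atTop, c n ∉ G (e j) := by
    rcases hc (e j) (heS j) with h | h
    · obtain ⟨n, hn, hn'⟩ := (frequently_atTop.1 h) N₁
      exact absurd hn' (hcB n hn)
    · exact h
  obtain ⟨N₂, hN₂⟩ := eventually_atTop.1 (hcG.and (eventually_ge_atTop N₁))
  have hN₂' : ∀ n ≥ N₂, (N₁ ≤ n ∧ c n ∉ G (e j)) := fun n hn => ⟨(hN₂ n hn).2, (hN₂ n hn).1⟩
  have hsub : ∀ n ≥ N₂, scan B G e (z n ++ [c n]) = (V (n + 1), (scan B G e (z n)).2 ++ [c n]) := by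
    intro n hn
    obtain ⟨h1, h2⟩ := hN₂' n hn
    rw [scan_concat, scanStep_of_notMem (by rw [hpc n h1]; exact hcB n h1)
      (by rw [hpc n h1]; exact h2), hval n h1, hVs n h1]
  have hcmp : ∀ n ≥ N₂, (scan B G e (z n)).2.length + 1 < (scan B G e (z (n + 1))).2.length ∨
      (scan B G e (z n)).2.length + 1 = (scan B G e (z (n + 1))).2.length ∧
        r j (scan B G e (z (n + 1))).2 ((scan B G e (z n)).2 ++ [c n]) := by
    intro n hn
    have h1 := (hN₂' n hn).1
    have h := (hN₀ n (by omega)).2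
    beta_reduce at h
    rw [hsub n hn] at h
    unfold scanRel at h
    simp only [hval (n + 1) (by omega), List.length_append,
      List.length_singleton, lt_irrefl, false_or, true_and] at h
    rwa [← hval (n + 1) (by omega), hpc (n + 1) (by omega)] at h
  -- the starting point of the scanned suffix is eventually constant
  obtain ⟨d, N₃, hN₃, hd⟩ : ∃ d, ∃ N₃ ≥ N₂, ∀ n ≥ N₃, d + (scan B G e (z n)).2.length = n := by
    choose f hf hf' using fun n => (scan_snd (B := B) (G := G) (e := e) (z n)).1
    have hfl : ∀ n ≥ N₂, f n + (scan B G e (z n)).2.length = n := fun n hn => by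
      have := (hN₂' n hn).1
      rw [hf n, (hN₀ n (by omega)).1]
    -- The word gains exactly one letter per step and the suffix at least one, so the start of the
    -- suffix never moves right.
    have hanti : Antitone fun k => f (N₂ + k) := antitone_nat_of_succ_le fun k => by
      have h1 := hfl (N₂ + k) (by omega)
      have h2 := hfl (N₂ + k + 1) (by omega)
      have h3 := hcmp (N₂ + k) (by omega)
      rw [← add_assoc]
      omega
    obtain ⟨k, hk⟩ := WellFoundedLT.antitone_chain_condition hanti
    refine ⟨f (N₂ + k), N₂ + k, by omega, fun n hn => ?_⟩
    obtain ⟨i, rfl⟩ := Nat.exists_eq_add_of_le hn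
    rw [hk (k + i) (by omega), ← add_assoc]
    exact hfl _ (by omega)
  have hdrop : ∀ n ≥ N₃, (scan B G e (z n)).2 = (z n).drop d := by
    intro n hn
    obtain ⟨⟨d', h1, h2⟩, -⟩ := scan_snd (B := B) (G := G) (e := e) (z n)
    have := (hN₂' n (by omega)).1
    rw [(hN₀ n (by omega)).1] at h1
    rw [h2]
    congr 1
    have := hd n hn
    omega
  -- Time is shifted by `d`, so that the suffix at time `n` has length `n`, as the induction
  -- hypothesis requires.
  have key := hr j (F.map (· - d)) (fun n => (scan B G e (z (n + d))).2) (fun n => c (n + d))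
    (fun n => y (n + d)) ((Filter.map_mono hF).trans (tendsto_sub_atTop_nat d)) ?_ ?_ ?_ ?_
  -- Each letter of `y` past `d` lies in the `G`-free suffix of some later word; this settles the
  -- pair `e j` omitted from `key`.
  · have hyG : ∀ n, y (n + d) ∉ G (e j) := by
      intro n
      obtain ⟨N, hN, hN'⟩ := ((hlim (n + d + 1)).and (hF' (max N₃ (n + d + 1)))).exists
      have h1 : N₃ ≤ N := le_trans (le_max_left _ _) hN'
      have h2 : n + d + 1 ≤ N := le_trans (le_max_right _ _) hN'
      have h3 := (scan_snd (B := B) (G := G) (e := e) (z N)).2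
      have h4 := (hN₂' N (by omega)).1
      rw [hdrop N h1, hpc N h4] at h3
      refine h3 _ ?_
      have h5 : (z N)[n + d]? = some (y (n + d)) := by
        have := congrArg (fun l => l[n + d]?) hN
        simpa [List.getElem?_take] using this
      refine List.mem_iff_getElem?.2 ⟨n, ?_⟩
      rw [List.getElem?_drop, add_comm, h5]
    intro s hs
    by_cases hsj : s = e j
    · subst hsj
      right
      filter_upwards [eventually_ge_atTop d] with n hn
      obtain ⟨k, rfl⟩ := Nat.exists_eq_add_of_le' hn
      exact hyG k
    · rcases key s (Finset.mem_erase.2 ⟨hsj, hs⟩) with h | h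
      · left
        exact (tendsto_add_atTop_nat d).frequently h
      · right
        rwa [← map_add_atTop_eq_nat d, eventually_map]
  · filter_upwards [eventually_ge_atTop N₃] with n hn
    have := hd (n + d) (by omega)
    omega
  · filter_upwards [eventually_ge_atTop N₃] with n hn
    have h1 := hd (n + d) (by omega)
    have h2 := hd (n + d + 1) (by omega)
    rcases hcmp (n + d) (by omega) with h | h
    · omega
    · rw [show n + 1 + d = n + d + 1 by ring]
      exact h.2
  · intro k
    rw [eventually_map]
    filter_upwards [hlim (k + d), hF' (max N₃ d)] with n hn hn'
    have h1 : N₃ ≤ n := le_trans (le_max_left _ _) hn'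
    have h2 : d ≤ n := le_trans (le_max_right _ _) hn'
    rw [Nat.sub_add_cancel h2, hdrop n h1, show k = k + d - d by omega, ← List.drop_take, hn]
    refine List.ext_getElem (by simp) fun i h1 h2 => ?_
    simp [add_comm]
  · intro s hs
    rcases hc s (Finset.mem_of_mem_erase hs) with h | h
    · left
      rwa [← map_add_atTop_eq_nat d, frequently_map] at h
    · right
      exact (tendsto_add_atTop_nat d).eventually h

end Streett

end GFG

namespace GFG

open Filter

/-! ## Partial plays and limits of partial plays -/

section Plays

variable {V L : Type*}

/-- The labels other than `ε` along a partial play. -/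
def labels (h : List (Edge V L)) : List L := h.filterMap Edge.label

theorem labels_append (h h' : List (Edge V L)) : labels (h ++ h') = labels h ++ labels h' :=
  List.filterMap_append

theorem labels_singleton (e : Edge V L) : labels [e] = e.label.toList := by
  unfold labels
  cases h : e.label <;> simp [h]

/-- The partial plays from `v₀` that agree with the strategy `τ` of Eve, with their last
positions. -/
inductive Arena.PlayTo (R : Arena V L) (τ : List (Edge V L) → V → Edge V L) (v₀ : V) :
    List (Edge V L) → V → Prop where
  | nil : Arena.PlayTo R τ v₀ [] v₀
  | concat {h : List (Edge V L)} (e : Edge V L) (hh : Arena.PlayTo R τ v₀ h e.src)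
      (he : R.IsTrans e) (hτ : e.src ∈ R.eve → e = τ h e.src) :
      Arena.PlayTo R τ v₀ (h ++ [e]) e.tgt

variable {R : Arena V L} {τ : List (Edge V L) → V → Edge V L} {v₀ : V}

theorem Arena.IsPath.concat {h : List (Edge V L)} {e : Edge V L} {v : V}
    (hh : R.IsPath v h e.src) (he : R.IsTrans e) : R.IsPath v (h ++ [e]) e.tgt := by
  induction h generalizing v with
  | nil => exact ⟨hh.symm, he, rfl⟩
  | cons a h ih => exact ⟨hh.1, hh.2.1, ih hh.2.2⟩

namespace Arena.PlayTo

theorem isPath {h : List (Edge V L)} {v : V} (hp : R.PlayTo τ v₀ h v) : R.IsPath v₀ h v := by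
  induction hp with
  | nil => rfl
  | concat e _ he _ ih => exact ih.concat he

theorem eq_of_nil {v : V} (hp : R.PlayTo τ v₀ [] v) : v = v₀ := by
  generalize hl : ([] : List (Edge V L)) = l at hp
  cases hp with
  | nil => rfl
  | concat e => simp at hl

theorem eq_of_concat {h : List (Edge V L)} {e : Edge V L} {v : V}
    (hp : R.PlayTo τ v₀ (h ++ [e]) v) : v = e.tgt := by
  generalize hl : h ++ [e] = l at hp
  cases hp with
  | nil => simp at hl
  | concat e' =>
    obtain ⟨-, h2⟩ := List.append_inj' hl rfl
    rw [List.singleton_inj.1 h2]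

theorem getElem? {h : List (Edge V L)} {v : V} (hp : R.PlayTo τ v₀ h v) {k : ℕ} {e : Edge V L}
    (hk : h[k]? = some e) : R.PlayTo τ v₀ (h.take k) e.src ∧ R.IsTrans e ∧
      (e.src ∈ R.eve → e = τ (h.take k) e.src) := by
  induction hp with
  | nil => simp at hk
  | @concat h e' hh he hτ ih =>
    rcases lt_trichotomy k h.length with hlt | rfl | hgt
    · rw [List.getElem?_append_left hlt] at hk
      rw [List.take_append_of_le_length hlt.le]
      exact ih hk
    · rw [List.getElem?_concat_length, Option.some_inj] at hk
      subst hk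
      rw [List.take_left']
      · exact ⟨hh, he, hτ⟩
      · rfl
    · rw [List.getElem?_eq_none (by simp; omega)] at hk
      simp at hk

theorem exists_take {h : List (Edge V L)} {v : V} (hp : R.PlayTo τ v₀ h v) (k : ℕ) :
    ∃ v', R.PlayTo τ v₀ (h.take k) v' := by
  rcases lt_or_ge k h.length with hk | hk
  · exact ⟨_, (hp.getElem? (List.getElem?_eq_getElem hk)).1⟩
  · exact ⟨v, by rwa [List.take_of_length_le hk]⟩

end Arena.PlayTo

theorem Arena.IsPlayFrom.playTo {π : ℕ → Edge V L} (hπ : R.IsPlayFrom v₀ π)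
    (hτ : R.Agrees τ π) (n : ℕ) : R.PlayTo τ v₀ ((List.range n).map π) (π n).src := by
  induction n with
  | zero => simpa [hπ.1] using Arena.PlayTo.nil
  | succ n ih =>
    rw [List.range_succ, List.map_append, ← (hπ.2 n).2]
    exact .concat _ ih (hπ.2 n).1 (hτ n)

theorem Arena.finite_playTo (hfin : ∀ v, {e | R.IsTrans e ∧ e.src = v}.Finite) (n : ℕ) :
    {p : List (Edge V L) × V | p.1.length = n ∧ R.PlayTo τ v₀ p.1 p.2}.Finite := by
  induction n with
  | zero =>
    refine (Set.finite_singleton ([], v₀)).subset ?_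
    rintro ⟨h, v⟩ ⟨hl, hp⟩
    obtain rfl : h = [] := List.length_eq_zero_iff.1 hl
    obtain rfl : v = v₀ := hp.eq_of_nil
    rfl
  | succ n ih =>
    refine (ih.biUnion fun p _ => (hfin p.2).image fun e => (p.1 ++ [e], e.tgt)).subset ?_
    rintro ⟨h, v⟩ ⟨hl, hp⟩
    cases hp with
    | nil => simp at hl
    | @concat h e hh he hτ =>
      have hl : h.length = n := by
        have : (h ++ [e]).length = n + 1 := hl
        simpa using this
      exact Set.mem_biUnion (x := (h, e.src)) ⟨hl, hh⟩ ⟨e, ⟨he, rfl⟩, rfl⟩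

/-- Partial plays whose lengths tend to infinity have a limit play. -/
theorem Arena.exists_limit_play (hfin : ∀ v, {e | R.IsTrans e ∧ e.src = v}.Finite)
    {h : ℕ → List (Edge V L)} {v : ℕ → V} (hp : ∀ n, R.PlayTo τ v₀ (h n) (v n))
    (hlen : ∀ n, n ≤ (h n).length) (F : Ultrafilter ℕ) (hF : (F : Filter ℕ) ≤ atTop) :
    ∃ π, R.IsPlayFrom v₀ π ∧ R.Agrees τ π ∧ IsWordLimit F h π := by
  have hF' : ∀ N, ∀ᶠ n in (F : Filter ℕ), N ≤ n := fun N => hF (eventually_ge_atTop N)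
  -- König's lemma: there are finitely many partial plays of length `m`, and an ultrafilter selects
  -- one of finitely many values.
  have hex : ∀ m, ∃ l, ∀ᶠ n in (F : Filter ℕ), (h n).take m = l := by
    intro m
    have hfin' := (Arena.finite_playTo (τ := τ) (v₀ := v₀) hfin m).image Prod.fst
    have : ∀ᶠ n in (F : Filter ℕ), ∃ l ∈ Prod.fst ''
        {p : List (Edge V L) × V | p.1.length = m ∧ R.PlayTo τ v₀ p.1 p.2}, (h n).take m = l := by
      filter_upwards [hF' m] with n hn
      obtain ⟨v', hv'⟩ := (hp n).exists_take m
      refine ⟨_, ⟨(_, v'), ⟨?_, hv'⟩, rfl⟩, rfl⟩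
      rw [List.length_take]
      have := hlen n
      omega
    rw [Ultrafilter.eventually_exists_mem_iff hfin'] at this
    obtain ⟨l, -, hl⟩ := this
    exact ⟨l, hl⟩
  choose l hl using hex
  have hget : ∀ m : ℕ, ∃ e, ∀ᶠ n in (F : Filter ℕ), (h n)[m]? = some e := by
    intro m
    obtain ⟨n, hn, hn'⟩ := ((hl (m + 1)).and (hF' (m + 1))).exists
    have hm : m < (h n).length := by have := hlen n; omega
    refine ⟨(h n)[m], ?_⟩
    filter_upwards [hl (m + 1)] with k hk
    have := congrArg (fun l : List (Edge V L) => l[m]?) (hk.trans hn.symm)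
    simpa [List.getElem?_take, hm] using this
  choose π hπ using hget
  have hlim : IsWordLimit F h π := by
    intro m
    have : ∀ᶠ n in (F : Filter ℕ), ∀ i ∈ Set.Iio m, (h n)[i]? = some (π i) :=
      (eventually_all_finite (Set.finite_Iio m)).2 fun i _ => hπ i
    filter_upwards [this] with n hn
    refine List.ext_getElem? fun i => ?_
    rw [List.getElem?_take, List.getElem?_map]
    split_ifs with hi
    · rw [hn i hi, List.getElem?_range hi]
      rfl
    · rw [List.getElem?_eq_none (by simp; omega)]
      rfl
  refine ⟨π, ⟨?_, fun i => ?_⟩, fun i hi => ?_, hlim⟩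
  · obtain ⟨n, hn⟩ := (hπ 0).exists
    exact ((hp n).getElem? hn).1.eq_of_nil
  · obtain ⟨n, hn, hn'⟩ := ((hπ i).and (hπ (i + 1))).exists
    refine ⟨((hp n).getElem? hn).2.1, ?_⟩
    have := ((hp n).getElem? hn').1
    rw [List.take_add_one, hn] at this
    exact this.eq_of_concat.symm
  · obtain ⟨n, hn, hn'⟩ := ((hlim i).and (hπ i)).exists
    rw [← hn]
    exact ((hp n).getElem? hn').2.2 hi

/-! ### Label words of infinite plays and of limits -/

theorem exists_isLabelWord {π : ℕ → Edge V L} (h : ∃ᶠ i in atTop, (π i).label ≠ none) :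
    ∃ u, IsLabelWord π u := by
  have hinf : {i | (π i).label ≠ none}.Infinite := Nat.frequently_atTop_iff_infinite.1 h
  have hs : ∀ n, ∃ l, (π (Nat.nth (fun i => (π i).label ≠ none) n)).label = some l := fun n =>
    Option.ne_none_iff_exists'.1 (Nat.nth_mem_of_infinite hinf n)
  choose u hu using hs
  refine ⟨u, _, Nat.nth_strictMono hinf, hu, fun i hi => ?_⟩
  rw [Nat.range_nth_of_infinite hinf] at hi
  simpa using hi

theorem labels_of_isLabelWord {π : ℕ → Edge V L} {u : ℕ → L} {φ : ℕ → ℕ} (hφ : StrictMono φ)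
    (hu : ∀ n, (π (φ n)).label = some (u n)) (hn : ∀ i, i ∉ Set.range φ → (π i).label = none)
    (n : ℕ) : labels ((List.range (φ n)).map π) = (List.range n).map u := by
  -- Here `k` counts the labelled edges before time `i`, so `φ k` is the first labelled time at or
  -- after `i`.
  have key : ∀ i, ∃ k, labels ((List.range i).map π) = (List.range k).map u ∧
      (∀ j < k, φ j < i) ∧ i ≤ φ k := by
    intro i
    induction i with
    | zero => exact ⟨0, by simp [labels], by simp, by simp⟩
    | succ i ih =>
      obtain ⟨k, h1, h2, h3⟩ := ih
      rw [List.range_succ, List.map_append, labels_append, h1, List.map_singleton,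
        labels_singleton]
      rcases h3.eq_or_lt with h3 | h3
      · refine ⟨k + 1, ?_, fun j hj => ?_, ?_⟩
        · rw [h3, hu, List.range_succ]; simp
        · have := hφ.monotone (Nat.lt_succ_iff.1 hj); omega
        · have : φ k < φ (k + 1) := hφ (Nat.lt_succ_self k); omega
      · refine ⟨k, ?_, fun j hj => (h2 j hj).trans (Nat.lt_succ_self i), h3⟩
        rw [hn i]
        · simp
        · rintro ⟨j, rfl⟩
          have h4 := hφ.lt_iff_lt.1 h3
          exact lt_irrefl _ (h2 j h4)
  obtain ⟨k, h1, h2, h3⟩ := key (φ n)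
  have h4 : n ≤ k := hφ.le_iff_le.1 h3
  have h5 : ¬ n < k := fun h => lt_irrefl _ (h2 n h)
  rw [h1, show k = n by omega]

theorem IsWordLimit.labels {F : Filter ℕ} {h : ℕ → List (Edge V L)} {π : ℕ → Edge V L}
    {u : ℕ → L} (hπ : IsWordLimit F h π) (hu : IsLabelWord π u) :
    IsWordLimit F (fun n => labels (h n)) u := by
  obtain ⟨φ, hφ, hu, hn⟩ := hu
  intro m
  filter_upwards [hπ (φ m)] with n hn'
  have := labels_of_isLabelWord hφ hu hn m
  rw [← List.take_append_drop (φ m) (h n), hn', labels_append, this, List.take_left']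
  simp

theorem IsWordLimit.map {T T' : Type*} {F : Filter ℕ} {z : ℕ → List T} {y : ℕ → T}
    (h : IsWordLimit F z y) (f : T → T') :
    IsWordLimit F (fun n => (z n).map f) (fun n => f (y n)) := by
  intro m
  filter_upwards [h m] with n hn
  rw [← List.map_take, hn, List.map_map]
  rfl

theorem IsWordLimit.eq_of_eventually {T : Type*} {F : Filter ℕ} [F.NeBot] {z : ℕ → List T}
    {y c : ℕ → T} (h : IsWordLimit F z y) (hF : F ≤ atTop)
    (hz : ∀ n, z n = (List.range n).map c) : y = c := by
  funext i
  obtain ⟨n, hn, hn'⟩ := ((h (i + 1)).and (hF (eventually_ge_atTop (i + 1)))).exists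
  have := congrArg (·[i]?) hn
  have hi : i < n := by have : i + 1 ≤ n := hn'; omega
  simpa [hz, List.getElem?_take, List.getElem?_range, hi] using this.symm

end Plays

/-! ## Positional determinacy -/

theorem exists_greatest_of_total {X : Type*} {r : X → X → Prop} (ht : ∀ x y, r x y ∨ r y x)
    (htr : ∀ x y z, r x y → r y z → r x z) {s : Set X} (hs : s.Finite) (hne : s.Nonempty) :
    ∃ m ∈ s, ∀ x ∈ s, r m x := by
  induction s, hs using Set.Finite.induction_on with
  | empty => simp at hne
  | @insert a s ha hs ih =>
    rcases s.eq_empty_or_nonempty with rfl | hne'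
    · exact ⟨a, by simp, by simpa using (ht a a)⟩
    obtain ⟨m, hm, hm'⟩ := ih hne'
    have haa : r a a := (ht a a).elim id id
    rcases ht a m with h | h
    · exact ⟨a, by simp, by
        rintro x (rfl | hx)
        exacts [haa, htr _ _ _ h (hm' x hx)]⟩
    · exact ⟨m, by simp [hm], by
        rintro x (rfl | hx)
        exacts [h, hm' x hx]⟩

/-- Consider a finitely branching game whose positions determine the word of first components read
so far. If Eve's winning condition is that this word belongs to a given set or that the sequence of
second components violates a Streett condition, then the game is positionally determined for
Eve. -/
theorem Game.positionallyDetermined_of_streett {V A T ι : Type*} [Finite T] (G : Game V (A × T))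
    (B D : ι → Set T) (S : Finset ι) (W : Set (ℕ → A))
    (hwin : ∀ u, u ∈ G.win ↔
      (fun i => (u i).1) ∈ W ∨ ¬ IsStreett B D S (fun i => (u i).2))
    (hfin : ∀ v, {e | G.arena.IsTrans e ∧ e.src = v}.Finite)
    (word : V → List A)
    (hword : ∀ τ h v, G.arena.PlayTo τ G.init h v → (labels h).map Prod.fst = word v)
    (hinf : ∀ π, G.arena.IsPlayFrom G.init π → ∃ᶠ i in atTop, (π i).label ≠ none) :
    G.PositionallyDeterminedForEve := by
  classical
  rintro ⟨τ, hτ, hτwin⟩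
  obtain ⟨r, hr_total, hr_trans, hr⟩ := exists_streett_preorder B D S
  have hgreatest : ∀ v, (∃ h, G.arena.PlayTo τ G.init h v) → ∃ h, G.arena.PlayTo τ G.init h v ∧
      ∀ h', G.arena.PlayTo τ G.init h' v →
        r ((labels h).map Prod.snd) ((labels h').map Prod.snd) := by
    rintro v ⟨h₀, hh₀⟩
    -- Only the label words of histories are compared; they have the length of `word v` over a
    -- finite alphabet, hence form a finite set.
    obtain ⟨x, ⟨h, hh, rfl⟩, hx⟩ := exists_greatest_of_total hr_total hr_trans
      (s := (fun h => (labels h).map Prod.snd) '' {h | G.arena.PlayTo τ G.init h v})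
      ((List.finite_length_eq T (word v).length).subset (by
        rintro _ ⟨h, hh, rfl⟩
        have := congrArg List.length (hword τ h v hh)
        simpa using this)) ⟨_, h₀, hh₀, rfl⟩
    exact ⟨h, hh, fun h' hh' => hx _ ⟨h', hh', rfl⟩⟩
  choose! H hH hHr using hgreatest
  -- The last two branches concern positions unreachable under `τ`; they only make `σ` total and
  -- legal.
  set σ : V → Edge V (A × T) := fun v =>
    if ∃ h, G.arena.PlayTo τ G.init h v then τ (H v) v
    else if hv : ∃ e : Edge V (A × T), e.src = v ∧ G.arena.IsTrans e then hv.choose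
    else (v, none, v) with hσ
  refine ⟨σ, fun _ v _ hv hterm => ?_, fun π hπ hag => ?_⟩
  · have hv' : ∃ e : Edge V (A × T), e.src = v ∧ G.arena.IsTrans e := by
      simp only [Arena.IsTerminal, not_forall, not_not] at hterm
      obtain ⟨l, v', h⟩ := hterm
      exact ⟨(v, l, v'), rfl, h⟩
    simp only [Arena.ofPositional, hσ]
    split_ifs with hreach
    · exact hτ _ v ⟨_, (hH v hreach).isPath⟩ hv hterm
    · exact hv'.choose_spec
  have hreach : ∀ i, ∃ h, G.arena.PlayTo τ G.init h (π i).src := by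
    intro i
    induction i with
    | zero => rw [hπ.1]; exact ⟨_, .nil⟩
    | succ i ih =>
      rw [← (hπ.2 i).2]
      refine ⟨_, .concat _ (hH _ ih) (hπ.2 i).1 fun he => ?_⟩
      have := hag i he
      simpa only [Arena.ofPositional, hσ, if_pos ih] using this
  -- Extending the chosen history by the edge played gives a history under `τ`, hence a competitor
  -- of the one chosen at the next position.
  have hplay : ∀ i, G.arena.PlayTo τ G.init (H (π i).src ++ [π i]) (π (i + 1)).src := by
    intro i
    rw [← (hπ.2 i).2]
    refine .concat _ (hH _ (hreach i)) (hπ.2 i).1 fun he => ?_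
    have := hag i he
    simpa only [Arena.ofPositional, hσ, if_pos (hreach i)] using this
  set x : ℕ → List T := fun i => (labels (H (π i).src)).map Prod.snd with hx
  have hstep : ∀ i, r (x (i + 1)) (x i ++ (π i).label.toList.map Prod.snd) := by
    intro i
    have := hHr _ (hreach (i + 1)) _ (hplay i)
    simpa only [labels_append, labels_singleton, List.map_append] using this
  obtain ⟨u, hu⟩ := exists_isLabelWord (hinf π hπ)
  refine ⟨u, (hwin u).2 ?_, hu⟩
  obtain ⟨φ, hφ, hφu, hφn⟩ := hu
  by_contra! hcon
  obtain ⟨hW, hStr⟩ := hcon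
  have hfst : ∀ n, (labels (H (π (φ n)).src)).map Prod.fst =
      (List.range n).map fun i => (u i).1 := by
    intro n
    -- `hword` is used for two strategies: for the history chosen under `τ` and for the actual play
    -- under `σ`.
    rw [hword τ _ _ (hH _ (hreach _)), ← hword _ _ _ (hπ.playTo hag (φ n)),
      labels_of_isLabelWord hφ hφu hφn, List.map_map]
    rfl
  have hlenl : ∀ n, (labels (H (π (φ n)).src)).length = n := fun n => by
    simpa using congrArg List.length (hfst n)
  have hF := Nat.hyperfilter_le_atTop
  obtain ⟨π', hπ', hag', hlim⟩ := Arena.exists_limit_play hfin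
    (fun n => hH _ (hreach (φ n)))
    (fun n => (hlenl n).symm.le.trans (List.length_filterMap_le _ _)) (hyperfilter ℕ) hF
  obtain ⟨u', hu'win, hu'⟩ := hτwin π' hπ' hag'
  have hlimu := hlim.labels hu'
  have heq : (fun i => (u' i).1) = fun i => (u i).1 :=
    (hlimu.map Prod.fst).eq_of_eventually hF hfst
  rcases (hwin u').1 hu'win with h | h
  · exact hW (heq ▸ h)
  refine h (hr _ _ (fun n => (u n).2) _ hF (.of_forall fun n => ?_) (.of_forall fun n => ?_)
    (hlimu.map Prod.snd) hStr)
  · simpa using hlenl n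
  -- Unlabelled edges add no letter, so domination passes through them by transitivity up to the
  -- next labelled one.
  · have : ∀ k, φ n + 1 + k ≤ φ (n + 1) → r (x (φ n + 1 + k)) (x (φ n) ++ [(u n).2]) := by
      intro k
      induction k with
      | zero =>
        intro _
        have := hstep (φ n)
        rwa [hφu] at this
      | succ k ih =>
        intro hk
        have h1 := hstep (φ n + 1 + k)
        rw [hφn, Option.toList_none, List.map_nil, List.append_nil] at h1
        · exact hr_trans _ _ _ h1 (ih (by omega))
        · rintro ⟨j, hj⟩
          have h2 : n < j := hφ.lt_iff_lt.1 (by omega)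
          have h3 : j < n + 1 := hφ.lt_iff_lt.1 (by omega)
          omega
    have hlt : φ n < φ (n + 1) := hφ (Nat.lt_succ_self n)
    have h1 := this (φ (n + 1) - (φ n + 1)) (by omega)
    rwa [show φ n + 1 + (φ (n + 1) - (φ n + 1)) = φ (n + 1) by omega] at h1

end GFG

namespace GFG

open Filter

/-! ## The acceptance conditions as negated Streett conditions -/

theorem frequently_mem_iff_infSet {T : Type*} [Finite T] (ρ : ℕ → T) (X : Set T) :
    (∃ᶠ n in atTop, ρ n ∈ X) ↔ (infSet ρ ∩ X).Nonempty := by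
  constructor
  · intro h
    have : ∃ᶠ n in atTop, ∃ t ∈ X, ρ n = t := h.mono fun n hn => ⟨_, hn, rfl⟩
    rw [frequently_exists_finite X.toFinite] at this
    obtain ⟨t, ht, ht'⟩ := this
    exact ⟨t, ht', ht⟩
  · rintro ⟨t, ht, ht'⟩
    exact Frequently.mono ht fun n hn => by rwa [hn]

theorem not_isStreett {T ι : Type*} {B G : ι → Set T} {S : Finset ι} {ρ : ℕ → T} :
    ¬ IsStreett B G S ρ ↔
      ∃ s ∈ S, (∀ᶠ n in atTop, ρ n ∉ B s) ∧ ∃ᶠ n in atTop, ρ n ∈ G s := by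
  unfold IsStreett
  push Not
  rfl

namespace AltAutomaton

variable {A Q : Type*} {𝒜 : AltAutomaton A Q}

theorem IsRabin.exists_streett [Finite A] [Finite Q] (h : 𝒜.IsRabin) :
    ∃ (ι : Type) (B G : ι → Set (Q × A × Q)) (S : Finset ι),
      ∀ ρ, ρ ∈ 𝒜.acc ↔ ¬ IsStreett B G S ρ := by
  obtain ⟨k, B, G, h⟩ := h
  refine ⟨Fin k, B, G, Finset.univ, fun ρ => ?_⟩
  rw [h, not_isStreett]
  refine exists_congr fun i => ?_
  rw [← Set.nonempty_iff_ne_empty, frequently_mem_iff_infSet, ← Set.not_nonempty_iff_eq_empty,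
    ← frequently_mem_iff_infSet, not_frequently]
  simp

theorem IsParity.exists_streett [Finite A] [Finite Q] (h : 𝒜.IsParity) :
    ∃ (ι : Type) (B G : ι → Set (Q × A × Q)) (S : Finset ι),
      ∀ ρ, ρ ∈ 𝒜.acc ↔ ¬ IsStreett B G S ρ := by
  obtain ⟨Ω, h⟩ := h
  obtain ⟨M, hM⟩ := (Set.finite_range Ω).bddAbove
  -- The pair `p` expresses that `p` is even, recurs, and is eventually not exceeded; `M` bounds the
  -- priorities, so finitely many pairs suffice.
  refine ⟨ℕ, fun p => {t | p < Ω t}, fun p => {t | Ω t = p ∧ Even p}, Finset.range (M + 1),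
    fun ρ => ?_⟩
  rw [h, not_isStreett]
  constructor
  · rintro ⟨p, ⟨hp, hmax⟩, heven⟩
    have hp' : ∃ᶠ n in atTop, Ω (ρ n) = p := hp
    refine ⟨p, ?_, ?_, hp'.mono fun n hn => ⟨hn, heven⟩⟩
    · obtain ⟨n, hn⟩ := hp'.exists
      exact Finset.mem_range_succ_iff.2 (hn ▸ hM (Set.mem_range_self (ρ n)))
    · rw [← not_frequently, frequently_mem_iff_infSet]
      rintro ⟨t, ht, ht'⟩
      have : Ω t ∈ infSet fun n => Ω (ρ n) := Frequently.mono ht fun n hn => congrArg Ω hn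
      exact absurd (hmax this) (not_le.2 ht')
  · rintro ⟨p, -, hB, hG⟩
    refine ⟨p, ⟨hG.mono fun n hn => hn.1, fun q hq => ?_⟩, hG.exists.choose_spec.2⟩
    obtain ⟨n, hn, hn'⟩ := (Frequently.and_eventually hq hB).exists
    exact hn ▸ not_lt.1 hn'

end AltAutomaton

/-! ## Transitions of products -/

theorem PosFormula.finite_subformulas {Q : Type*} (b : PosFormula Q) : b.subformulas.Finite := by
  induction b with
  | atom q => exact Set.finite_singleton _
  | or b₁ b₂ h₁ h₂ => exact (Set.finite_singleton _).union (h₁.union h₂)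
  | and b₁ b₂ h₁ h₂ => exact (Set.finite_singleton _).union (h₁.union h₂)

theorem PosFormula.sizeOf_lt_of_mem_children {Q : Type*} {b b' : PosFormula Q}
    (h : b' ∈ b.children) : sizeOf b' < sizeOf b := by
  cases b with
  | atom q => exact h.elim
  | or b₁ b₂ => rcases h with rfl | rfl <;> simp +arith
  | and b₁ b₂ => rcases h with rfl | rfl <;> simp +arith

/-! ### Moving formula positions between arenas -/

namespace ProdPos

variable {V V' A Q : Type*} {D : Set (PosFormula Q)}

/-- The component in the arena. -/
def base : ProdPos V A Q D → V
  | state v _ => v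
  | formula v _ _ _ => v

/-- The position with the component in the arena replaced by `v'`. -/
def relocate (v' : V') : ProdPos V A Q D → ProdPos V' A Q D
  | state _ q => state v' q
  | formula _ q a b => formula v' q a b

end ProdPos

/-- The edge with the components in the arena of both ends replaced by `v'`. -/
def Edge.relocate {V V' A Q L : Type*} {D : Set (PosFormula Q)} (v' : V')
    (e : Edge (ProdPos V A Q D) L) : Edge (ProdPos V' A Q D) L :=
  (e.src.relocate v', e.label, e.tgt.relocate v')

namespace AltAutomaton

variable {A Q : Type*} {𝒜 : AltAutomaton A Q}

theorem finite_subformulas [Finite A] [Finite Q] : 𝒜.subformulas.Finite := by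
  have : 𝒜.subformulas = ⋃ q, ⋃ a, (𝒜.δ q a).subformulas := by
    ext b
    simp [subformulas]
  rw [this]
  exact Set.finite_iUnion fun q => Set.finite_iUnion fun a => (𝒜.δ q a).finite_subformulas

section

variable {V V' : Type*} {R : Arena V A} {R' : Arena V' A}

theorem ProdTrans.of_formula {v : V} {q : Q} {a : A} {b : 𝒜.subformulas}
    {l : Option (A × (Q × A × Q))} {p : 𝒜.Pos V}
    (h : 𝒜.ProdTrans R (ProdPos.formula v q a b) l p) :
    (l = none ∧ ∃ b' : 𝒜.subformulas, b'.1 ∈ b.1.children ∧ p = ProdPos.formula v q a b') ∨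
      ∃ q', l = some (a, (q, a, q')) ∧ p = ProdPos.state v q' := by
  cases h with
  | choice _ _ _ _ b' hb => exact .inl ⟨rfl, b', hb, rfl⟩
  | leaf _ _ _ _ q' hb => exact .inr ⟨q', rfl, rfl⟩

/-- Inside a formula the arena component is a passive tag. This lets the moves of Eve be copied from
one product to another. -/
theorem ProdTrans.relocate (v' : V') {v : V} {q : Q} {a : A} {b : 𝒜.subformulas}
    {l : Option (A × (Q × A × Q))} {p : 𝒜.Pos V}
    (h : 𝒜.ProdTrans R (ProdPos.formula v q a b) l p) :
    𝒜.ProdTrans R' (ProdPos.formula v' q a b) l (p.relocate v') := by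
  cases h with
  | choice _ _ _ _ b' hb => exact .choice _ _ _ _ _ hb
  | leaf _ _ _ _ q' hb => exact .leaf _ _ _ _ _ hb

theorem exists_formula_of_mem_eve (hR : R.eve = ∅) {p : 𝒜.Pos V} (hp : p ∈ (𝒜.prod R).eve) :
    ∃ v q a b, p = ProdPos.formula v q a b ∧ b.1.IsOr := by
  cases p with
  | state v q =>
    have : v ∈ R.eve := hp
    rw [hR] at this
    exact this.elim
  | formula v q a b => exact ⟨v, q, a, b, rfl, hp⟩

end

/-! ## The letter games -/

theorem ProdTrans.of_state_expanded {u : List A} {q : Q}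
    {l : Option (A × (Q × A × Q))} {p : 𝒜.Pos (List A)}
    (h : 𝒜.ProdTrans (expandedLetterArena A) (ProdPos.state u q) l p) :
    l = none ∧ ∃ a, ∃ b : 𝒜.subformulas, b.1 = 𝒜.δ q a ∧
      p = ProdPos.formula (u ++ [a]) q a b := by
  cases h with
  | letter _ _ _ a b hR hb =>
    obtain ⟨a', h1, rfl⟩ := hR
    obtain rfl := Option.some_inj.1 h1
    exact ⟨rfl, a, b, hb, rfl⟩
  | eps _ _ _ hR => obtain ⟨a', h1, -⟩ := hR; cases h1

theorem ProdTrans.base_prefix {l : Option (A × (Q × A × Q))} {p p' : 𝒜.Pos (List A)}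
    (h : 𝒜.ProdTrans (expandedLetterArena A) p l p') : p.base <+: p'.base := by
  cases p with
  | state u q =>
    obtain ⟨-, a, b, -, rfl⟩ := h.of_state_expanded
    exact List.prefix_append _ _
  | formula u q a b =>
    rcases h.of_formula with ⟨-, b', -, rfl⟩ | ⟨q', -, rfl⟩
    exacts [List.prefix_rfl, List.prefix_rfl]

/-- The word of the letters in a label. -/
def labelWord {X : Type*} (l : Option (A × X)) : List A := l.toList.map Prod.fst

theorem wordRead_concat {V : Type*} (h : List (Edge V (A × (Q × A × Q)))) (e : Edge V _) :
    wordRead (h ++ [e]) = wordRead h ++ labelWord e.label := by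
  rw [wordRead, List.filterMap_append, List.map_append]
  exact congrArg _ (congrArg _ (labels_singleton e))

theorem collapsePos_expandPos (w : List A) (p : 𝒜.Pos Unit) :
    𝒜.collapsePos (𝒜.expandPos w p) = p := by
  cases p <;> rfl

theorem relocate_unit_relocate {V : Type*} (v : V) (p : 𝒜.Pos Unit) :
    (p.relocate v).relocate () = p := by
  cases p <;> rfl

theorem ProdTrans.expand {p p' : 𝒜.Pos Unit} {l : Option (A × (Q × A × Q))}
    (h : 𝒜.ProdTrans (letterArena A) p l p') (w : List A) :
    𝒜.ProdTrans (expandedLetterArena A) (𝒜.expandPos w p) l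
      (𝒜.expandPos (w ++ labelWord l) p') := by
  cases h with
  | letter _ _ q a b _ hb =>
    simpa [labelWord, expandPos] using ProdTrans.letter (R := expandedLetterArena A) w (w ++ [a])
      q a b ⟨a, rfl, rfl⟩ hb
  | eps _ _ _ hR => obtain ⟨a', h1⟩ := hR; cases h1
  | choice _ q a b b' hb =>
    simpa [labelWord, expandPos] using ProdTrans.choice (R := expandedLetterArena A) (w ++ [a])
      q a b b' hb
  | leaf _ q a b q' hb => exact .leaf _ q a b q' hb

theorem ProdTrans.collapse {p p' : 𝒜.Pos (List A)} {l : Option (A × (Q × A × Q))}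
    (h : 𝒜.ProdTrans (expandedLetterArena A) p l p') :
    𝒜.ProdTrans (letterArena A) (𝒜.collapsePos p) l (𝒜.collapsePos p') := by
  cases h with
  | letter _ _ q a b _ hb => exact .letter _ _ q a b ⟨a, rfl⟩ hb
  | eps _ _ _ hR => obtain ⟨a', h1, -⟩ := hR; cases h1
  | choice _ q a b b' hb => exact .choice _ q a b b' hb
  | leaf _ q a b q' hb => exact .leaf _ q a b q' hb

/-- The word forgotten by collapsing can be recovered from the letters generated so far; at a
formula position the pending letter is stored in the position itself. -/
theorem ProdTrans.expand_collapse {w : List A} {p : 𝒜.Pos Unit} {p' : 𝒜.Pos (List A)}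
    {l : Option (A × (Q × A × Q))}
    (h : 𝒜.ProdTrans (expandedLetterArena A) (𝒜.expandPos w p) l p') :
    𝒜.expandPos (w ++ labelWord l) (𝒜.collapsePos p') = p' := by
  cases p with
  | state _ q =>
    obtain ⟨rfl, a, b, -, rfl⟩ := ProdTrans.of_state_expanded h
    simp [labelWord, expandPos, collapsePos]
  | formula _ q a b =>
    rcases ProdTrans.of_formula h with ⟨rfl, b', -, rfl⟩ | ⟨q', rfl, rfl⟩
    · simp [labelWord, expandPos, collapsePos]
    · rfl

theorem expandPos_wordRead_of_playTo
    {τ : List (Edge (𝒜.Pos (List A)) (A × (Q × A × Q))) → 𝒜.Pos (List A) → Edge _ _}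
    {h : List (Edge (𝒜.Pos (List A)) (A × (Q × A × Q)))} {p : 𝒜.Pos (List A)}
    (hp : (𝒜.prod (expandedLetterArena A)).PlayTo τ 𝒜.expandedLetterGame.init h p) :
    𝒜.expandPos (wordRead h) (𝒜.collapsePos p) = p := by
  induction hp with
  | nil => rfl
  | @concat h e _ he _ ih =>
    rw [wordRead_concat]
    refine ProdTrans.expand_collapse (p := 𝒜.collapsePos e.src) ?_
    rw [ih]
    exact he

theorem finite_expanded_trans [Finite A] [Finite Q] (p : 𝒜.Pos (List A)) :
    {e | (𝒜.prod (expandedLetterArena A)).IsTrans e ∧ e.src = p}.Finite := by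
  have := (finite_subformulas (𝒜 := 𝒜)).to_subtype
  cases p with
  | state u q =>
    refine (Set.finite_range fun x : A × 𝒜.subformulas =>
      ((ProdPos.state u q : 𝒜.Pos (List A)), (none : Option (A × (Q × A × Q))),
        (ProdPos.formula (u ++ [x.1]) q x.1 x.2 : 𝒜.Pos (List A)))).subset ?_
    rintro ⟨_, l, p'⟩ ⟨h, rfl⟩
    obtain ⟨h1, a, b, -, h2⟩ := ProdTrans.of_state_expanded h
    refine ⟨(a, b), ?_⟩
    simp only [Edge.label, Edge.tgt] at h1 h2
    rw [h1, h2]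
  | formula u q a b =>
    refine ((Set.finite_range fun b' : 𝒜.subformulas =>
      ((ProdPos.formula u q a b : 𝒜.Pos (List A)), (none : Option (A × (Q × A × Q))),
        (ProdPos.formula u q a b' : 𝒜.Pos (List A)))).union (Set.finite_range fun q' : Q =>
      ((ProdPos.formula u q a b : 𝒜.Pos (List A)), some (a, (q, a, q')),
        (ProdPos.state u q' : 𝒜.Pos (List A))))).subset ?_
    rintro ⟨_, l, p'⟩ ⟨h, rfl⟩
    rcases ProdTrans.of_formula h with ⟨h1, b', -, h2⟩ | ⟨q', h1, h2⟩
    · left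
      refine ⟨b', ?_⟩
      simp only [Edge.label, Edge.tgt] at h1 h2
      rw [h1, h2]
    · right
      refine ⟨q', ?_⟩
      simp only [Edge.label, Edge.tgt] at h1 h2
      rw [h1, h2]

/-- A play without further labels would descend forever through ever smaller formulas, since states
lead only to formulas and only leaves, which carry labels, lead back. -/
theorem frequently_label_expanded {v₀ : 𝒜.Pos (List A)}
    {π : ℕ → Edge (𝒜.Pos (List A)) (A × (Q × A × Q))}
    (hπ : (𝒜.prod (expandedLetterArena A)).IsPlayFrom v₀ π) :
    ∃ᶠ i in atTop, (π i).label ≠ none := by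
  by_contra hcon
  rw [not_frequently] at hcon
  obtain ⟨N, hN⟩ := eventually_atTop.1 hcon
  have hN' : ∀ i ≥ N, (π i).label = none := fun i hi => not_not.1 (hN i hi)
  have key : ∀ n, ∀ i ≥ N, ∀ u q a b, (π i).src = ProdPos.formula u q a b →
      sizeOf b.1 ≠ n := by
    intro n
    induction n using Nat.strong_induction_on with
    | _ n ih =>
    intro i hi u q a b hb hn
    have h := (hπ.2 i).1
    rw [Arena.IsTrans, hb] at h
    rcases ProdTrans.of_formula h with ⟨-, b', hb', h2⟩ | ⟨q', h1, -⟩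
    · have := PosFormula.sizeOf_lt_of_mem_children hb'
      rw [(hπ.2 i).2] at h2
      exact ih _ (hn ▸ this) (i + 1) (by omega) _ _ _ _ h2 rfl
    · rw [hN' i hi] at h1
      cases h1
  cases hs : (π N).src with
  | formula u q a b => exact key _ N le_rfl _ _ _ _ hs rfl
  | state u q =>
    have h := (hπ.2 N).1
    rw [Arena.IsTrans, hs] at h
    obtain ⟨-, a, b, -, h2⟩ := ProdTrans.of_state_expanded h
    rw [(hπ.2 N).2] at h2
    exact key _ (N + 1) (by omega) _ _ _ _ h2 rfl

theorem expandedLetterGame_positionallyDetermined [Finite A] [Finite Q]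
    (h𝒜 : 𝒜.IsRabin ∨ 𝒜.IsParity) : 𝒜.expandedLetterGame.PositionallyDeterminedForEve := by
  obtain ⟨ι, B, D, S, hacc⟩ : ∃ (ι : Type) (B G : ι → Set (Q × A × Q)) (S : Finset ι),
      ∀ ρ, ρ ∈ 𝒜.acc ↔ ¬ IsStreett B G S ρ :=
    h𝒜.elim IsRabin.exists_streett IsParity.exists_streett
  refine Game.positionallyDetermined_of_streett 𝒜.expandedLetterGame B D S
    {w | w ∉ 𝒜.language} (fun u => or_congr Iff.rfl (hacc _)) finite_expanded_trans
    (fun p => match p with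
      | ProdPos.state u _ => u
      -- At `(wa, q, a, b)` the letter `a` has been chosen but not yet generated.
      | ProdPos.formula u _ _ _ => u.dropLast) (fun τ h p hp => ?_)
    (fun π hπ => frequently_label_expanded hπ)
  have := expandPos_wordRead_of_playTo hp
  rw [← this]
  cases p <;> simp [expandPos, collapsePos, wordRead, labels]

end AltAutomaton

end GFG

namespace GFG

open Filter

namespace AltAutomaton

variable {A Q : Type*} {𝒜 : AltAutomaton A Q}

/-! ## Transfer of strategies between the letter games -/

theorem collapsePos_eq_relocate (p : 𝒜.Pos (List A)) : 𝒜.collapsePos p = p.relocate () := by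
  cases p <;> rfl

theorem ProdTrans.relocate_unit {p p' : 𝒜.Pos (List A)} {l : Option (A × (Q × A × Q))}
    (h : 𝒜.ProdTrans (expandedLetterArena A) p l p') :
    𝒜.ProdTrans (letterArena A) (p.relocate ()) l (p'.relocate ()) := by
  simpa only [collapsePos_eq_relocate] using h.collapse

theorem isPath_relocate_unit {p p' : 𝒜.Pos (List A)}
    {h : List (Edge (𝒜.Pos (List A)) (A × (Q × A × Q)))}
    (hp : (𝒜.prod (expandedLetterArena A)).IsPath p h p') :
    (𝒜.prod (letterArena A)).IsPath (p.relocate ()) (h.map (Edge.relocate ()))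
      (p'.relocate ()) := by
  induction h generalizing p with
  | nil =>
    obtain rfl : p = p' := hp
    rfl
  | cons e h ih =>
    obtain ⟨rfl, h2, h3⟩ := hp
    exact ⟨rfl, ProdTrans.relocate_unit h2, ih h3⟩

/-- An ∃-GFG automaton's letter game strategy can be used in the expanded letter game. -/
theorem IsExistsGFG.eveWins_expanded (h : 𝒜.IsExistsGFG) : 𝒜.expandedLetterGame.EveWins := by
  obtain ⟨τ, hτ, hτwin⟩ := h
  have heve : ∀ p : 𝒜.Pos (List A), p ∈ (𝒜.prod (expandedLetterArena A)).eve →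
      ∃ u q a b, p = ProdPos.formula u q a b ∧ b.1.IsOr :=
    fun p hp => exists_formula_of_mem_eve rfl hp
  have hval : ∀ h p, (𝒜.prod (expandedLetterArena A)).IsHistory h p →
      p ∈ (𝒜.prod (expandedLetterArena A)).eve →
      ¬ (𝒜.prod (expandedLetterArena A)).IsTerminal p →
      (τ (h.map (Edge.relocate ())) (p.relocate ())).src = p.relocate () ∧
      (𝒜.prod (letterArena A)).IsTrans (τ (h.map (Edge.relocate ())) (p.relocate ())) := by
    rintro h p ⟨v₀, hh⟩ hp hterm
    refine hτ _ _ ⟨_, isPath_relocate_unit hh⟩ ?_ fun hterm' => hterm fun l p' ht => ?_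
    · obtain ⟨u, q, a, b, rfl, hb⟩ := heve p hp
      exact hb
    · exact hterm' l _ (ProdTrans.relocate_unit ht)
  -- Eve moves only at disjunctions, where the word does not change, so restoring the word of `p` at
  -- both ends is correct.
  refine ⟨fun h p => (τ (h.map (Edge.relocate ())) (p.relocate ())).relocate p.base, ?_, ?_⟩
  · intro h p hh hp hterm
    obtain ⟨h1, h2⟩ := hval h p hh hp hterm
    obtain ⟨u, q, a, b, rfl, hb⟩ := heve p hp
    rw [Arena.IsTrans, h1] at h2
    refine ⟨?_, ?_⟩
    · simp only [Edge.relocate, Edge.src] at h1 ⊢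
      rw [h1]
      rfl
    · have := ProdTrans.relocate (R' := expandedLetterArena A) u h2
      rw [Arena.IsTrans]
      simp only [Edge.relocate, Edge.src] at h1 ⊢
      rw [h1]
      exact this
  · intro π hπ hag
    have hplay : (𝒜.prod (letterArena A)).IsPlayFrom 𝒜.letterGame.init
        fun i => (π i).relocate () :=
      ⟨congrArg (ProdPos.relocate ()) hπ.1, fun i => ⟨ProdTrans.relocate_unit (hπ.2 i).1,
        congrArg (ProdPos.relocate ()) (hπ.2 i).2⟩⟩
    have hagree : (𝒜.prod (letterArena A)).Agrees τ fun i => (π i).relocate () := by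
      intro i hi
      have hi' : (π i).src ∈ (𝒜.prod (expandedLetterArena A)).eve := by
        obtain ⟨v, q, a, b, hb, hb'⟩ := exists_formula_of_mem_eve rfl hi
        cases hs : (π i).src with
        | state u q' =>
          have : ((π i).src).relocate () = ProdPos.formula v q a b := hb
          rw [hs] at this
          cases this
        | formula u q' a' b'' =>
          have : ((π i).src).relocate () = ProdPos.formula v q a b := hb
          rw [hs] at this
          cases this
          exact hb'
      have h1 := congrArg (Edge.relocate ()) (hag i hi')
      refine h1.trans ?_
      rw [show (List.range i).map (fun i => (π i).relocate ()) =
        ((List.range i).map π).map (Edge.relocate ()) by rw [List.map_map]; rfl]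
      refine Prod.ext ?_ (Prod.ext rfl ?_)
      · exact relocate_unit_relocate _ _
      · exact relocate_unit_relocate _ _
    obtain ⟨u, hu, hu'⟩ := hτwin _ hplay hagree
    exact ⟨u, hu, hu'⟩

theorem letterStrategy_isEveWinning {σ : 𝒜.Pos (List A) → Edge (𝒜.Pos (List A)) (A × (Q × A × Q))}
    (hσ : 𝒜.expandedLetterGame.IsPositionalEveWinning σ) :
    𝒜.letterGame.IsEveWinning (𝒜.letterStrategy σ) := by
  obtain ⟨hval, hwin⟩ := hσ
  have hval' : ∀ p, p ∈ (𝒜.prod (expandedLetterArena A)).eve →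
      ¬ (𝒜.prod (expandedLetterArena A)).IsTerminal p →
      (σ p).src = p ∧ (𝒜.prod (expandedLetterArena A)).IsTrans (σ p) :=
    fun p => hval [] p ⟨p, rfl⟩
  have heve : ∀ w (p : 𝒜.Pos Unit), p ∈ (𝒜.prod (letterArena A)).eve →
      𝒜.expandPos w p ∈ (𝒜.prod (expandedLetterArena A)).eve := by
    intro w p hp
    obtain ⟨v, q, a, b, rfl, hb⟩ := exists_formula_of_mem_eve rfl hp
    exact hb
  refine ⟨fun h p _ hp hterm => ?_, fun π hπ hag => ?_⟩
  · obtain ⟨h1, h2⟩ := hval' (𝒜.expandPos (wordRead h) p) (heve _ _ hp) fun hterm' =>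
      hterm fun l p' ht => hterm' l _ (ProdTrans.expand ht _)
    refine ⟨?_, ProdTrans.collapse h2⟩
    exact (congrArg 𝒜.collapsePos h1).trans (collapsePos_expandPos _ _)
  set w : ℕ → List A := fun i => wordRead ((List.range i).map π) with hw
  have hws : ∀ i, w (i + 1) = w i ++ labelWord (π i).label := fun i => by
    simp only [hw, List.range_succ, List.map_append, List.map_singleton, wordRead_concat]
  have htrans : ∀ i, (𝒜.prod (expandedLetterArena A)).IsTrans
      (𝒜.expandPos (w i) (π i).src, (π i).label, 𝒜.expandPos (w (i + 1)) (π i).tgt) := by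
    intro i
    rw [hws]
    exact ProdTrans.expand (hπ.2 i).1 _
  have hagree : (𝒜.prod (expandedLetterArena A)).Agrees (Arena.ofPositional σ) fun i =>
      (𝒜.expandPos (w i) (π i).src, (π i).label, 𝒜.expandPos (w (i + 1)) (π i).tgt) := by
    intro i hi
    have hi' : (π i).src ∈ (𝒜.prod (letterArena A)).eve := by
      obtain ⟨v, q, a, b, hb, hb'⟩ := exists_formula_of_mem_eve rfl hi
      cases hs : (π i).src with
      | state _ q' =>
        have : 𝒜.expandPos (w i) (π i).src = ProdPos.formula v q a b := hb
        rw [hs] at this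
        cases this
      | formula _ q' a' b'' =>
        have : 𝒜.expandPos (w i) (π i).src = ProdPos.formula v q a b := hb
        rw [hs] at this
        cases this
        exact hb'
    have hπi : π i = (𝒜.collapsePos (σ (𝒜.expandPos (w i) (π i).src)).src,
        (σ (𝒜.expandPos (w i) (π i).src)).label,
        𝒜.collapsePos (σ (𝒜.expandPos (w i) (π i).src)).tgt) := hag i hi'
    obtain ⟨h1, h2⟩ := hval' (𝒜.expandPos (w i) (π i).src) hi
      fun hterm => hterm _ _ (htrans i)
    have hl : (π i).label = (σ (𝒜.expandPos (w i) (π i).src)).label :=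
      congrArg (fun e => e.2.1) hπi
    have ht : (π i).tgt = 𝒜.collapsePos (σ (𝒜.expandPos (w i) (π i).src)).tgt :=
      congrArg (fun e => e.2.2) hπi
    refine Prod.ext h1.symm (Prod.ext hl ?_)
    rw [Arena.IsTrans, h1] at h2
    -- The target is known only up to collapsing; the word read so far restores it.
    have h3 := ProdTrans.expand_collapse h2
    rw [← hl, ← hws, ← ht] at h3
    exact h3
  have hplay : (𝒜.prod (expandedLetterArena A)).IsPlayFrom 𝒜.expandedLetterGame.init fun i =>
      (𝒜.expandPos (w i) (π i).src, (π i).label, 𝒜.expandPos (w (i + 1)) (π i).tgt) :=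
    ⟨congrArg (𝒜.expandPos (w 0)) hπ.1, fun i =>
      ⟨htrans i, congrArg (𝒜.expandPos (w (i + 1))) (hπ.2 i).2⟩⟩
  obtain ⟨u, hu, hu'⟩ := hwin _ hplay hagree
  exact ⟨u, hu, hu'⟩

/-! ## Boxes -/

/-- Words only grow along a play, so one leading from `w` to `wa` uses no other edge of the word
tree, and it can be copied to and from the one-step arena. -/
theorem strategyBox_mem_boxes {σ : 𝒜.Pos (List A) → Edge (𝒜.Pos (List A)) (A × (Q × A × Q))}
    (hσ : (𝒜.prod (expandedLetterArena A)).IsPositionalEveStrategy σ) (u : NonemptyWord A) :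
    𝒜.strategyBox σ u ∈ 𝒜.boxes u.last := by
  obtain ⟨w, a, hu⟩ : ∃ w a, u.1 = w ++ [a] := ⟨_, _, (List.dropLast_append_getLast u.2).symm⟩
  obtain ⟨u, hne⟩ := u
  obtain rfl : u = w ++ [a] := hu
  have hlast : NonemptyWord.last ⟨w ++ [a], hne⟩ = a := List.getLast_concat
  set σ' : 𝒜.Pos Bool → Edge (𝒜.Pos Bool) (A × (Q × A × Q)) :=
    fun p => (σ (p.relocate (w ++ [a]))).relocate p.base with hσ'
  have hval : ∀ p, p ∈ (𝒜.prod (expandedLetterArena A)).eve →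
      ¬ (𝒜.prod (expandedLetterArena A)).IsTerminal p →
      (σ p).src = p ∧ (𝒜.prod (expandedLetterArena A)).IsTrans (σ p) :=
    fun p => hσ [] p ⟨p, rfl⟩
  have hvalid : (𝒜.prod (oneStepArena a)).IsPositionalEveStrategy σ' := by
    intro h p _ hp hterm
    obtain ⟨v, q, a', b, rfl, hb⟩ := exists_formula_of_mem_eve rfl hp
    obtain ⟨h1, h2⟩ := hval (ProdPos.formula (w ++ [a]) q a' b) hb fun hterm' =>
      hterm fun l p' ht => hterm' l _ (ProdTrans.relocate (w ++ [a]) ht)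
    rw [Arena.IsTrans, h1] at h2
    have h3 := ProdTrans.relocate (R' := oneStepArena a) v h2
    have h4 : (σ' (ProdPos.formula v q a' b)).src = ProdPos.formula v q a' b :=
      congrArg (ProdPos.relocate v) h1
    refine ⟨h4, ?_⟩
    rw [Arena.IsTrans, Arena.ofPositional, h4]
    exact h3
  have hstate : ∀ u (q : Q),
      (ProdPos.state u q : 𝒜.Pos (List A)) ∉ (𝒜.prod (expandedLetterArena A)).eve := by
    intro u q h
    obtain ⟨_, _, _, _, h, -⟩ := exists_formula_of_mem_eve rfl h
    cases h
  have hstate' : ∀ v (q : Q),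
      (ProdPos.state v q : 𝒜.Pos Bool) ∉ (𝒜.prod (oneStepArena a)).eve := by
    intro u q h
    obtain ⟨_, _, _, _, h, -⟩ := exists_formula_of_mem_eve rfl h
    cases h
  refine ⟨σ', by rwa [hlast], ?_⟩
  ext ⟨q, a', q'⟩
  simp only [strategyBox, box, hlast, Set.mem_ofPred_eq, List.dropLast_concat]
  refine and_congr_right fun _ => ⟨fun h => ?_, fun h => ?_⟩
  -- The last alternative collects plays that have left the prefixes of `wa`; these can never
  -- return.
  · have key : ∀ p, (𝒜.prod (expandedLetterArena A)).ReachesUnder σ (ProdPos.state w q) p →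
        p = ProdPos.state w q ∨
        (∃ b, p = ProdPos.formula (w ++ [a]) q a b ∧
          (𝒜.prod (oneStepArena a)).ReachesUnder σ' (ProdPos.state false q)
            (ProdPos.formula true q a b)) ∨
        (∃ q', p = ProdPos.state (w ++ [a]) q' ∧
          (𝒜.prod (oneStepArena a)).ReachesUnder σ' (ProdPos.state false q)
            (ProdPos.state true q')) ∨ ¬ p.base <+: w ++ [a] := by
      intro p hp
      induction hp with
      | refl => exact .inl rfl
      | @tail p p' _ hstep ih =>
        obtain ⟨l, ht, hag⟩ := hstep
        rcases ih with rfl | ⟨b, rfl, hb⟩ | ⟨q'', rfl, -⟩ | hnot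
        · obtain ⟨rfl, a'', b, hb, rfl⟩ := ProdTrans.of_state_expanded ht
          by_cases haa : a'' = a
          · subst haa
            exact .inr (.inl ⟨b, rfl, .single ⟨none,
              .letter false true q a'' b ⟨rfl, rfl, rfl⟩ hb, fun h => (hstate' _ _ h).elim⟩⟩)
          · refine .inr (.inr (.inr fun hpre => haa ?_))
            have := hpre.eq_of_length (by simp [ProdPos.base])
            simpa [ProdPos.base] using this
        · have hstep' : (𝒜.prod (oneStepArena a)).ReachesUnder σ' (ProdPos.state false q)
              (p'.relocate true) := by
            refine hb.tail ⟨l, ProdTrans.relocate true ht, fun hor => ?_⟩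
            have := hag hor
            exact congrArg (Edge.relocate true) this
          rcases ProdTrans.of_formula ht with ⟨-, b', -, rfl⟩ | ⟨q'', -, rfl⟩
          · exact .inr (.inl ⟨b', rfl, hstep'⟩)
          · exact .inr (.inr (.inl ⟨q'', rfl, hstep'⟩))
        · obtain ⟨rfl, a'', b, hb, rfl⟩ := ProdTrans.of_state_expanded ht
          refine .inr (.inr (.inr fun hpre => ?_))
          have := hpre.length_le
          simp [ProdPos.base] at this
        · exact .inr (.inr (.inr fun hpre => hnot ((ProdTrans.base_prefix ht).trans hpre)))
    rcases key _ h with h | ⟨b, h, -⟩ | ⟨q'', h, h'⟩ | h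
    · simp at h
    · cases h
    · cases h
      exact h'
    · exact (h List.prefix_rfl).elim
  · have key : ∀ p, (𝒜.prod (oneStepArena a)).ReachesUnder σ' (ProdPos.state false q) p →
        p = ProdPos.state false q ∨
        (∃ b, p = ProdPos.formula true q a b ∧
          (𝒜.prod (expandedLetterArena A)).ReachesUnder σ (ProdPos.state w q)
            (ProdPos.formula (w ++ [a]) q a b)) ∨
        (∃ q', p = ProdPos.state true q' ∧
          (𝒜.prod (expandedLetterArena A)).ReachesUnder σ (ProdPos.state w q)
            (ProdPos.state (w ++ [a]) q')) := by
      intro p hp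
      induction hp with
      | refl => exact .inl rfl
      | @tail p p' _ hstep ih =>
        obtain ⟨l, ht, hag⟩ := hstep
        rcases ih with rfl | ⟨b, rfl, hb⟩ | ⟨q'', rfl, -⟩
        · cases ht with
          | letter _ _ _ a'' b hR hb =>
            obtain ⟨-, h1, rfl⟩ := hR
            obtain rfl := Option.some_inj.1 h1
            exact .inr (.inl ⟨b, rfl, .single ⟨none,
              .letter w (w ++ [a'']) q a'' b ⟨a'', rfl, rfl⟩ hb,
              fun h => (hstate _ _ h).elim⟩⟩)
          | eps _ _ _ hR => cases hR.2.1
        · have hstep' : (𝒜.prod (expandedLetterArena A)).ReachesUnder σ (ProdPos.state w q)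
              (p'.relocate (w ++ [a])) := by
            refine hb.tail ⟨l, ProdTrans.relocate _ ht, fun hor => ?_⟩
            obtain ⟨h1, h2⟩ := hval (ProdPos.formula (w ++ [a]) q a b) hor fun hterm =>
              hterm _ _ (ProdTrans.relocate _ ht)
            have h3 : (σ (ProdPos.formula (w ++ [a]) q a b)).relocate true =
              (ProdPos.formula true q a b, l, p') := hag hor
            rw [Arena.IsTrans, h1] at h2
            -- Relocation hides the word at the target of `σ`; legality of the move forces it to be
            -- `wa`.
            refine Prod.ext h1 (Prod.ext (congrArg (fun e => e.2.1) h3) ?_)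
            have h4 : (σ (ProdPos.formula (w ++ [a]) q a b)).tgt.relocate true = p' :=
              congrArg (fun e => e.2.2) h3
            rw [← h4]
            change (σ (ProdPos.formula (w ++ [a]) q a b)).tgt = _
            rcases ProdTrans.of_formula h2 with ⟨-, b', -, h5⟩ | ⟨q'', -, h5⟩ <;> rw [h5] <;> rfl
          rcases ProdTrans.of_formula ht with ⟨-, b', -, rfl⟩ | ⟨q'', -, rfl⟩
          · exact .inr (.inl ⟨b', rfl, hstep'⟩)
          · exact .inr (.inr ⟨q'', rfl, hstep'⟩)
        · cases ht with
          | letter _ _ _ a'' b hR hb => cases hR.1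
          | eps _ _ _ hR => cases hR.1
    rcases key _ h with h | ⟨b, h, -⟩ | ⟨q'', h, h'⟩
    · cases h
    · cases h
    · cases h
      exact h'

/-! ### From paths of boxes to plays -/

/-- A partial play that agrees with a positional strategy can be continued along a path that
witnesses a triple of the box of the next letter. -/
theorem exists_playTo_of_reachesUnder {v₀ : 𝒜.Pos (List A)}
    {σ : 𝒜.Pos (List A) → Edge (𝒜.Pos (List A)) (A × (Q × A × Q))}
    {h : List (Edge (𝒜.Pos (List A)) (A × (Q × A × Q)))} {w : List A} {a : A} {q q' : Q}
    (hp : (𝒜.prod (expandedLetterArena A)).PlayTo (Arena.ofPositional σ) v₀ h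
      (ProdPos.state w q))
    (hr : (𝒜.prod (expandedLetterArena A)).ReachesUnder σ (ProdPos.state w q)
      (ProdPos.state (w ++ [a]) q')) :
    ∃ h', (𝒜.prod (expandedLetterArena A)).PlayTo (Arena.ofPositional σ) v₀ h'
      (ProdPos.state (w ++ [a]) q') ∧ labels h' = labels h ++ [(a, (q, a, q'))] := by
  have key : ∀ p, (𝒜.prod (expandedLetterArena A)).ReachesUnder σ (ProdPos.state w q) p →
      ∃ h', (𝒜.prod (expandedLetterArena A)).PlayTo (Arena.ofPositional σ) v₀ h' p ∧
        (p = ProdPos.state w q ∧ labels h' = labels h ∨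
        (∃ a b, p = ProdPos.formula (w ++ [a]) q a b ∧ labels h' = labels h) ∨
        (∃ a q', p = ProdPos.state (w ++ [a]) q' ∧ labels h' = labels h ++ [(a, (q, a, q'))]) ∨
        w.length + 1 < p.base.length) := by
    intro p hp'
    induction hp' with
    | refl => exact ⟨h, hp, .inl ⟨rfl, rfl⟩⟩
    | @tail p p' _ hstep ih =>
      obtain ⟨l, ht, hag⟩ := hstep
      obtain ⟨h', hh', hl⟩ := ih
      refine ⟨h' ++ [(p, l, p')], .concat (p, l, p') hh' ht fun he => (hag he).symm, ?_⟩
      rw [labels_append, labels_singleton]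
      rcases hl with ⟨rfl, hl⟩ | ⟨a, b, rfl, hl⟩ | ⟨a, q', rfl, hl⟩ | hl
      · obtain ⟨rfl, a'', b, hb, rfl⟩ := ProdTrans.of_state_expanded ht
        exact .inr (.inl ⟨a'', b, rfl, by simp [hl, Edge.label]⟩)
      · rcases ProdTrans.of_formula ht with ⟨rfl, b', -, rfl⟩ | ⟨q'', rfl, rfl⟩
        · exact .inr (.inl ⟨a, b', rfl, by simp [hl, Edge.label]⟩)
        · exact .inr (.inr (.inl ⟨a, q'', rfl, by simp [hl, Edge.label]⟩))
      · obtain ⟨rfl, a'', b, hb, rfl⟩ := ProdTrans.of_state_expanded ht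
        exact .inr (.inr (.inr (by simp [ProdPos.base])))
      · exact .inr (.inr (.inr (hl.trans_le (ProdTrans.base_prefix ht).length_le)))
  obtain ⟨h', hh', hl⟩ := key _ hr
  refine ⟨h', hh', ?_⟩
  rcases hl with ⟨h1, -⟩ | ⟨a, b, h1, -⟩ | ⟨a, q', h1, hl⟩ | hl
  · simp at h1
  · cases h1
  · simp only [ProdPos.state.injEq, List.append_cancel_left_eq, List.cons.injEq, and_true] at h1
    rw [hl, h1.1, h1.2]
  · simp [ProdPos.base] at hl

/-- Since the strategy is positional, witnesses for successive boxes can be glued into partial plays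
of every length. Those chosen for different lengths need not extend one another, so a compactness
limit supplies the infinite play. -/
theorem universallyAccepting_strategyBox [Finite A] [Finite Q]
    {σ : 𝒜.Pos (List A) → Edge (𝒜.Pos (List A)) (A × (Q × A × Q))}
    (hσ : 𝒜.expandedLetterGame.IsPositionalEveWinning σ) {w : ℕ → A} (hw : w ∈ 𝒜.language) :
    𝒜.UniversallyAccepting fun i => 𝒜.strategyBox σ (wordPrefix w i) := by
  intro ρ hinit hchain hbox
  have hplay : ∀ n, ∃ h, (𝒜.prod (expandedLetterArena A)).PlayTo (Arena.ofPositional σ)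
      𝒜.expandedLetterGame.init h (ProdPos.state ((List.range n).map w) (ρ n).1) ∧
      labels h = (List.range n).map fun i => (w i, ρ i) := by
    intro n
    induction n with
    | zero => exact ⟨[], by rw [hinit]; exact .nil, rfl⟩
    | succ n ih =>
      obtain ⟨h, hh, hl⟩ := ih
      obtain ⟨h1, h2⟩ := hbox n
      have h3 : (wordPrefix w n).1 = (List.range n).map w ++ [w n] := by
        simp [wordPrefix, List.range_succ]
      have h4 : (wordPrefix w n).last = w n := by
        simp [NonemptyWord.last, h3]
      rw [h3, List.dropLast_concat, hchain n] at h2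
      obtain ⟨h', hh', hl'⟩ := exists_playTo_of_reachesUnder hh h2
      refine ⟨h', by rwa [List.range_succ, List.map_append], ?_⟩
      rw [hl', hl, List.range_succ, List.map_append, List.map_singleton, ← hchain n, ← h4, ← h1]
  choose h hh hl using hplay
  have hlen : ∀ n, (labels (h n)).length = n := by simp [hl]
  have hF := Nat.hyperfilter_le_atTop
  obtain ⟨π, hπ, hag, hlim⟩ := Arena.exists_limit_play finite_expanded_trans hh
    (fun n => (hlen n).ge.trans (List.length_filterMap_le Edge.label (h n)))
    (hyperfilter ℕ) hF
  obtain ⟨u, hu, hu'⟩ := hσ.2 π hπ hag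
  -- Although the limit play is not explicit, its label word is forced to be the given word paired
  -- with `ρ`.
  obtain rfl := (hlim.labels hu').eq_of_eventually hF hl
  exact hu.resolve_left fun hw' => hw' hw

end AltAutomaton

end GFG

theorem mainTheorem8 {A Q : Type*} [Finite A] [Nonempty A] [Finite Q]
    (𝒜 : GFG.AltAutomaton A Q) (h𝒜 : 𝒜.IsRabin ∨ 𝒜.IsParity) :
    𝒜.expandedLetterGame.PositionallyDeterminedForEve ∧
    (𝒜.IsExistsGFG →
      ∃ σ, 𝒜.expandedLetterGame.IsPositionalEveWinning σ ∧
        𝒜.letterGame.IsEveWinning (𝒜.letterStrategy σ) ∧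
        (∀ u : GFG.NonemptyWord A, 𝒜.strategyBox σ u ∈ 𝒜.boxes u.last) ∧
        ∀ w ∈ 𝒜.language,
          𝒜.UniversallyAccepting fun i => 𝒜.strategyBox σ (GFG.wordPrefix w i)) := by
  have hdet := GFG.AltAutomaton.expandedLetterGame_positionallyDetermined h𝒜
  refine ⟨hdet, fun hGFG => ?_⟩
  obtain ⟨σ, hσ⟩ := hdet hGFG.eveWins_expanded
  exact ⟨σ, hσ, GFG.AltAutomaton.letterStrategy_isEveWinning hσ,
    GFG.AltAutomaton.strategyBox_mem_boxes hσ.1,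
    fun w hw => GFG.AltAutomaton.universallyAccepting_strategyBox hσ hw⟩
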